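/- **Setting (SoteriaFL).** There are $n$ clients; client $i$ holds a local dataset $D_i=(d_{i,1},\dots,d_{i,m})$ of $m$ samples from a set $\mathcal X$. Fix a minibatch size $1\le b\le m$, an initial point $x^0\in\mathbb R^d$, stepsizes $\eta_t,\gamma_t\in\mathbb R$ and a noise level $\sigma_p\ge 0$, and put $s^0=s_i^0=0$. In each round $t=0,1,\dots,T$, every client $i$ * draws a random minibatch $\mathcal I_i^t\subseteq\{1,\dots,m\}$ that contains each index independently with probability $b/m$; * computes the local gradient estimator $$\tilde g_i^t=\mathcal A_i^t+\mathcal B_i^t,\qquad \mathcal A_i^t=\frac1b\sum_{j\in\mathcal I_i^t}\varphi_{i,j}^t,\qquad \mathcal B_i^t=\frac1m\sum_{j=1}^m\psi_{i,j}^t;$$ * sets $g_i^t=\tilde g_i^t+\xi_i^t$ with $\xi_i^t\sim\mathcal N(0,\sigma_p^2 I)$, and sends $v_i^t=\mathcal C_i^t(g_i^t-s_i^t)$ to the server, where $\mathcal C_i^t:\mathbb R^d\to\mathbb R^d$ is a randomized (compression) map; * updates $s_i^{t+1}=s_i^t+\gamma_t v_i^t$. The server sets $v^t=s^t+\frac1n\sum_{i=1}^n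 v_i^t$, $x^{t+1}=x^t-\eta_t v^t$ and $s^{t+1}=s^t+\gamma_t\frac1n\sum_{i=1}^n v_i^t$. All minibatches, noises and compression maps are independent across clients and rounds, and of each other. The vectors $\varphi_{i,j}^t,\psi_{i,j}^t\in\mathbb R^d$ are (measurable) functions of the sample $d_{i,j}$, of the iterates $x^0,\dots,x^t$, of all messages sent in the rounds before $t$, of a random seed that is independent of the data and of all other randomness, and of the information in which earlier rounds $j$ belonged to the minibatch of client $i$. (This covers the SGD, SVRG and SAGA estimators.) They are bounded: $\|\varphi_{i,j}^t\|\le G_A$ and $\|\psi_{i,j}^t\|\le G_B$ for all values of their arguments. **LDP.** Let $\mathcal M(D)$ be the collection of all messages $(v_i^t)_{i\le n,\,0\le t\le T}$ when the algorithm runs on $D=(D_1,\dots,D_n)$. SoteriaFL is $(\epsilon,\delta)$-LDP if for every client $i$, all $D,D'$ with $D_k=D'_k$ for $k\ne i$ and with $D_i,D'_i$ differing in at most one entry, and every measurable set $S$, $\Pr\{\mathcal M(D)\in S\}\le e^{\epsilon}\Pr\{\mathcal M(D')\in S\}+\delta$. **Theorem.** There is an absolute constant $c'>0$, and for every $K>0$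 there is a constant $c>0$ that depends only on $K$, such that the following holds for all such $n,m,d,b,T$, datasets, estimators, compression maps, stepsizes, $G_A$ and $G_B$. If $\delta\in(0,1)$, $0<\epsilon<c'\,b^2T/m^2$ and $\epsilon\le K\log(1/\delta)$, and if $$\sigma_p^2=c\,\frac{(G_A^2/4+G_B^2)\,T\log(1/\delta)}{m^2\epsilon^2},$$ then SoteriaFL is $(\epsilon,\delta)$-LDP. -/

import Mathlib

open MeasureTheory ProbabilityTheory

noncomputable section

namespace SoteriaFL

/-! ### Local differential privacy -/

/-- Two local datasets with `m` samples are neighbors if they differ by (at most) one entry. -/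
def Neighbors {m : ℕ} {𝒳 : Type*} (D D' : Fin m → 𝒳) : Prop :=
  ∃ j, ∀ k, k ≠ j → D k = D' k

/-- `(ε, δ)`-local differential privacy for client `i`.  A mechanism sends the collection
`D = (D_1, …, D_n)` of all local datasets to the law of its output.  The local dataset of client
`i` is replaced by a neighboring one, the data of the other clients are kept fixed. -/
def IsLDPFor {n m : ℕ} {𝒳 Out : Type*} [MeasurableSpace Out]
    (M : (Fin n → Fin m → 𝒳) → Measure Out) (ε δ : ℝ) (i : Fin n) : Prop :=
  ∀ D D' : Fin n → Fin m → 𝒳, Neighbors (D i) (D' i) → (∀ k, k ≠ i → D k = D' k) →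
    ∀ S : Set Out, MeasurableSet S →
      M D S ≤ ENNReal.ofReal (Real.exp ε) * M D' S + ENNReal.ofReal δ

/-- `(ε, δ)`-local differential privacy, for every client. -/
def IsLDP {n m : ℕ} {𝒳 Out : Type*} [MeasurableSpace Out]
    (M : (Fin n → Fin m → 𝒳) → Measure Out) (ε δ : ℝ) : Prop :=
  ∀ i, IsLDPFor M ε δ i

/-! ### Public quantities: messages, shifts, iterates -/

/-- The model space `ℝ^d` with its Euclidean norm. -/
abbrev Vec (d : ℕ) := EuclideanSpace ℝ (Fin d)

/-- All messages `v_i^s` sent to the server in the rounds `s < t`. -/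
abbrev Messages (n d t : ℕ) := Fin t → Fin n → Vec d

/-- The messages of the first `s ≤ t` rounds. -/
def Messages.take {n d t : ℕ} (v : Messages n d t) (s : ℕ) (hs : s ≤ t) : Messages n d s :=
  fun r => v (Fin.castLE hs r)

/-- The average `(1/n) ∑ i, v_i` of the messages of one round. -/
def average {n d : ℕ} (v : Fin n → Vec d) : Vec d :=
  (1 / (n : ℝ)) • ∑ i, v i

/-- The reference of client `i`: `s_i^0 = 0` and `s_i^{t+1} = s_i^t + γ_t v_i^t`. -/
def clientShift {n d : ℕ} (γ : ℕ → ℝ) (i : Fin n) : (t : ℕ) → Messages n d t → Vec d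
  | 0, _ => 0
  | t + 1, v => clientShift γ i t (Fin.init v) + γ t • v (Fin.last t) i

/-- The reference of the server: `s^0 = 0` and `s^{t+1} = s^t + γ_t (1/n) ∑ i, v_i^t`. -/
def serverShift {n d : ℕ} (γ : ℕ → ℝ) : (t : ℕ) → Messages n d t → Vec d
  | 0, _ => 0
  | t + 1, v => serverShift γ t (Fin.init v) + γ t • average (v (Fin.last t))

/-- The model: `x^{t+1} = x^t - η_t v^t`, where `v^t = s^t + (1/n) ∑ i, v_i^t`. -/
def iterate {n d : ℕ} (x₀ : Vec d) (η γ : ℕ → ℝ) : (t : ℕ) → Messages n d t → Vec d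
  | 0, _ => x₀
  | t + 1, v => iterate x₀ η γ t (Fin.init v) -
      η t • (serverShift γ t (Fin.init v) + average (v (Fin.last t)))

/-! ### Local gradient estimators -/

/-- What the contribution of one sample of a client may depend on in round `t`, besides the sample
itself: the iterates `x^0, …, x^t`, the messages of all clients in the rounds `s < t`, a
data-independent random seed of the estimator (for instance the coins that choose the snapshot
points of SVRG), and in which of the rounds `s < t` this very sample was in the minibatch of its
client (which determines the points `w_{i,j}^t` of SAGA). -/
abbrev View (n d : ℕ) (R : Type*) (t : ℕ) :=
  (Fin (t + 1) → Vec d) × Messages n d t × R × (Fin t → Bool)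

/-- The functions `φ_{i,j}^t`, `ψ_{i,j}^t` of a local gradient estimator, and the law of its
seed. -/
structure Estimator (n m d : ℕ) (𝒳 R : Type*) [MeasurableSpace R] where
  φ : Fin n → (t : ℕ) → Fin m → 𝒳 → View n d R t → Vec d
  ψ : Fin n → (t : ℕ) → Fin m → 𝒳 → View n d R t → Vec d
  seedLaw : Measure R
  measurable_φ : ∀ i t j z, Measurable (φ i t j z)
  measurable_ψ : ∀ i t j z, Measurable (ψ i t j z)
  isProbabilityMeasure_seedLaw : IsProbabilityMeasure seedLaw

/-- Randomized maps `C_i^t : ℝ^d → ℝ^d`: in round `t`, client `i` draws a fresh seed `u` and sends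
`x` to `apply i t u x`. -/
structure Compressors (n d : ℕ) (U : Type*) [MeasurableSpace U] where
  apply : Fin n → ℕ → U → Vec d → Vec d
  seedLaw : Fin n → ℕ → Measure U
  measurable_apply : ∀ i t, Measurable (fun p : U × Vec d => apply i t p.1 p.2)
  isProbabilityMeasure_seedLaw : ∀ i t, IsProbabilityMeasure (seedLaw i t)

/-- The estimator `A_i^t + B_i^t` of client `i` in round `t`, where
`A_i^t = (1/b) ∑_{j ∈ I} φ_{i,j}^t` and `B_i^t = (1/m) ∑_j ψ_{i,j}^t`. -/
def Estimator.gradient {n m d : ℕ} {𝒳 R : Type*} [MeasurableSpace R] (E : Estimator n m d 𝒳 R)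
    (b : ℕ) (i : Fin n) (t : ℕ) (Di : Fin m → 𝒳) (view : Fin m → View n d R t)
    (I : Fin m → Bool) : Vec d :=
  (1 / (b : ℝ)) • (∑ j with I j = true, E.φ i t j (Di j) (view j)) +
    (1 / (m : ℝ)) • ∑ j, E.ψ i t j (Di j) (view j)

/-! ### The algorithm -/

/-- The fresh randomness of a client in one round: the indicators of its minibatch, its Gaussian
perturbation and the seed of its compressor. -/
abbrev ClientCoins (m d : ℕ) (U : Type*) := (Fin m → Bool) × Vec d × U

/-- The messages of the first `t` rounds, as a function of the data and of the randomness. -/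
def run {n m d : ℕ} {𝒳 R U : Type*} [MeasurableSpace R] [MeasurableSpace U]
    (b : ℕ) (x₀ : Vec d) (η γ : ℕ → ℝ) (E : Estimator n m d 𝒳 R) (C : Compressors n d U)
    (D : Fin n → Fin m → 𝒳) (r : R) :
    (t : ℕ) → (Fin t → Fin n → ClientCoins m d U) → Messages n d t
  | 0, _ => Fin.elim0
  | t + 1, ω =>
    let v := run b x₀ η γ E C D r t (Fin.init ω)
    Fin.snoc (α := fun _ => Fin n → Vec d) v fun i =>
      let view : Fin m → View n d R t := fun j =>
        (fun s => iterate x₀ η γ s (v.take s (Nat.le_of_lt_succ s.isLt)), v, r,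
          fun s => (ω s.castSucc i).1 j)
      let g := E.gradient b i t (D i) view (ω (Fin.last t) i).1 + (ω (Fin.last t) i).2.1
      C.apply i t (ω (Fin.last t) i).2.2 (g - clientShift γ i t v)

/-- The sampling probability `q = b / m`. -/
def samplingRate {b m : ℕ} (h : b ≤ m) : unitInterval :=
  ⟨(b : ℝ) / m, by positivity, div_le_one_of_le₀ (by exact_mod_cast h) (by positivity)⟩

/-- The Gaussian law `N(0, σ² I)` on `ℝ^d`. -/
def gaussianNoise (d : ℕ) (σ : ℝ) : Measure (Vec d) :=
  (stdGaussian (Vec d)).map (fun x => σ • x)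

/-- The law of the fresh randomness of client `i` in round `t`: each sample is put into the
minibatch independently with probability `b / m`, the perturbation is `N(0, σ² I)`, and all parts
are independent. -/
def coinsLaw {n m d b : ℕ} {U : Type*} [MeasurableSpace U] (h : b ≤ m) (σ : ℝ)
    (C : Compressors n d U) (i : Fin n) (t : ℕ) : Measure (ClientCoins m d U) :=
  (Measure.pi fun _ : Fin m => bernoulliMeasure true false (samplingRate h)).prod
    ((gaussianNoise d σ).prod (C.seedLaw i t))

/-- The law of all the randomness of the rounds `0, 1, …, T`, independent across rounds and
clients, together with the independent seed of the estimator. -/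
def randomnessLaw {n m d b : ℕ} {𝒳 R U : Type*} [MeasurableSpace R] [MeasurableSpace U]
    (h : b ≤ m) (T : ℕ) (σ : ℝ) (E : Estimator n m d 𝒳 R) (C : Compressors n d U) :
    Measure (R × (Fin (T + 1) → Fin n → ClientCoins m d U)) :=
  E.seedLaw.prod (Measure.pi fun t => Measure.pi fun i => coinsLaw h σ C i t)

/-- SoteriaFL, run for the rounds `t = 0, 1, …, T`, as a mechanism: the law of everything that the
clients send to the server, as a function of the local datasets. -/
def mechanism {n m d b : ℕ} {𝒳 R U : Type*} [MeasurableSpace R] [MeasurableSpace U]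
    (h : b ≤ m) (T : ℕ) (σ : ℝ) (x₀ : Vec d) (η γ : ℕ → ℝ) (E : Estimator n m d 𝒳 R)
    (C : Compressors n d U) (D : Fin n → Fin m → 𝒳) : Measure (Messages n d (T + 1)) :=
  (randomnessLaw h T σ E C).map fun ω => run b x₀ η γ E C D ω.1 (T + 1) ω.2

/-! ### The mechanism is well defined -/

section WellDefined

variable {n m d b : ℕ} {𝒳 R U : Type*} [MeasurableSpace R] [MeasurableSpace U]

instance (σ : ℝ) : IsProbabilityMeasure (gaussianNoise d σ) :=
  Measure.isProbabilityMeasure_map (by fun_prop)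

instance (h : b ≤ m) (σ : ℝ) (C : Compressors n d U) (i : Fin n) (t : ℕ) :
    IsProbabilityMeasure (coinsLaw (m := m) h σ C i t) := by
  have := C.isProbabilityMeasure_seedLaw i t
  unfold coinsLaw
  infer_instance

instance (h : b ≤ m) (T : ℕ) (σ : ℝ) (E : Estimator n m d 𝒳 R) (C : Compressors n d U) :
    IsProbabilityMeasure (randomnessLaw h T σ E C) := by
  have := E.isProbabilityMeasure_seedLaw
  unfold randomnessLaw
  infer_instance

theorem measurable_clientShift (γ : ℕ → ℝ) (i : Fin n) (t : ℕ) :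
    Measurable (clientShift (d := d) γ i t) := by
  induction t with
  | zero => exact measurable_const
  | succ t ih =>
    have h1 : Measurable (fun v : Messages n d (t + 1) => (Fin.init v : Messages n d t)) :=
      measurable_pi_lambda _ fun s => measurable_pi_apply _
    have h2 : Measurable (fun v : Messages n d (t + 1) => v (Fin.last t) i) :=
      (measurable_pi_apply i).comp (measurable_pi_apply _)
    exact (ih.comp h1).add (h2.const_smul (γ t))

theorem measurable_average : Measurable (average (n := n) (d := d)) := by
  unfold average
  have h : Measurable (fun v : Fin n → Vec d => ∑ i, v i) :=
    Finset.measurable_sum _ fun i _ => measurable_pi_apply i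
  exact h.const_smul (1 / (n : ℝ))

theorem measurable_serverShift (γ : ℕ → ℝ) (t : ℕ) :
    Measurable (serverShift (n := n) (d := d) γ t) := by
  induction t with
  | zero => exact measurable_const
  | succ t ih =>
    have h1 : Measurable (fun v : Messages n d (t + 1) => (Fin.init v : Messages n d t)) :=
      measurable_pi_lambda _ fun s => measurable_pi_apply _
    have h2 : Measurable (fun v : Messages n d (t + 1) => average (v (Fin.last t))) :=
      measurable_average.comp (measurable_pi_apply _)
    exact (ih.comp h1).add (h2.const_smul (γ t))

theorem measurable_iterate (x₀ : Vec d) (η γ : ℕ → ℝ) (t : ℕ) :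
    Measurable (iterate (n := n) x₀ η γ t) := by
  induction t with
  | zero => exact measurable_const
  | succ t ih =>
    have h1 : Measurable (fun v : Messages n d (t + 1) => (Fin.init v : Messages n d t)) :=
      measurable_pi_lambda _ fun s => measurable_pi_apply _
    have h2 : Measurable (fun v : Messages n d (t + 1) => average (v (Fin.last t))) :=
      measurable_average.comp (measurable_pi_apply _)
    exact (ih.comp h1).sub ((((measurable_serverShift γ t).comp h1).add h2).const_smul (η t))

theorem measurable_run (x₀ : Vec d) (η γ : ℕ → ℝ) (E : Estimator n m d 𝒳 R)
    (C : Compressors n d U) (D : Fin n → Fin m → 𝒳) (t : ℕ) :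
    Measurable (fun ω : R × (Fin t → Fin n → ClientCoins m d U) =>
      run b x₀ η γ E C D ω.1 t ω.2) := by
  induction t with
  | zero => exact measurable_const
  | succ t ih =>
    have hinit : Measurable (fun ω : R × (Fin (t + 1) → Fin n → ClientCoins m d U) =>
        (ω.1, (Fin.init ω.2 : Fin t → Fin n → ClientCoins m d U))) :=
      measurable_fst.prodMk (measurable_pi_lambda _ fun s =>
        (measurable_pi_apply s.castSucc).comp measurable_snd)
    have hv := ih.comp hinit
    have hc : ∀ (s : Fin (t + 1)) (i : Fin n),
        Measurable (fun ω : R × (Fin (t + 1) → Fin n → ClientCoins m d U) => ω.2 s i) :=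
      fun s i => (measurable_pi_apply i).comp ((measurable_pi_apply s).comp measurable_snd)
    refine measurable_pi_lambda _ fun s => ?_
    induction s using Fin.lastCases with
    | cast s =>
      simp only [run, Fin.snoc_castSucc]
      exact (measurable_pi_apply s).comp hv
    | last =>
      simp only [run, Fin.snoc_last]
      refine measurable_pi_lambda _ fun i => ?_
      refine (C.measurable_apply i t).comp (Measurable.prodMk (hc _ i).snd.snd ?_)
      refine Measurable.sub (Measurable.add ?_ (hc _ i).snd.fst)
        ((measurable_clientShift γ i t).comp hv)
      have hview : ∀ j : Fin m, Measurable
          (fun ω : R × (Fin (t + 1) → Fin n → ClientCoins m d U) =>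
            (((fun s => iterate x₀ η γ s
                ((run b x₀ η γ E C D ω.1 t (Fin.init ω.2)).take s (Nat.le_of_lt_succ s.isLt))),
              run b x₀ η γ E C D ω.1 t (Fin.init ω.2), ω.1,
              fun s => (ω.2 s.castSucc i).1 j) : View n d R t)) := by
        intro j
        refine Measurable.prodMk ?_ (hv.prodMk (measurable_fst.prodMk ?_))
        · refine measurable_pi_lambda _ fun s => (measurable_iterate x₀ η γ s).comp ?_
          exact measurable_pi_lambda _ fun r => (measurable_pi_apply _).comp hv
        · exact measurable_pi_lambda _ fun s => (measurable_pi_apply j).comp (hc _ i).fst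
      unfold Estimator.gradient
      refine Measurable.add (Measurable.const_smul (c := 1 / (b : ℝ)) ?_)
        (Measurable.const_smul (c := 1 / (m : ℝ)) ?_)
      · simp only [Finset.sum_filter]
        refine Finset.measurable_sum _ fun j _ => Measurable.ite ?_
          ((E.measurable_φ i t j (D i j)).comp (hview j)) measurable_const
        exact ((measurable_pi_apply j).comp (hc (Fin.last t) i).fst) (measurableSet_singleton true)
      · exact Finset.measurable_sum _ fun j _ => (E.measurable_ψ i t j (D i j)).comp (hview j)

instance (h : b ≤ m) (T : ℕ) (σ : ℝ) (x₀ : Vec d) (η γ : ℕ → ℝ) (E : Estimator n m d 𝒳 R)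
    (C : Compressors n d U) (D : Fin n → Fin m → 𝒳) :
    IsProbabilityMeasure (mechanism h T σ x₀ η γ E C D) :=
  Measure.isProbabilityMeasure_map (measurable_run x₀ η γ E C D (T + 1)).aemeasurable

end WellDefined

end SoteriaFL

end

/-!
Privacy is proved conditionally on the seed of the estimator (`isLDP_of_forall_seed`), for two runs
whose data differ in sample `j` of client `i`. Let a *hidden indicator* be the coin that tells
whether this sample is drawn in a round. Compared with the run from which the sample is erased
(`Estimator.erase`), the sample only adds a vector to the gradient, and since the gradient enters
the message as a sum with the Gaussian noise, this amounts to a shift of the noise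
(`run_eq_run_erasedCoins`). By the Cameron–Martin formula (`map_add_stdGaussian`), a shift of the
noise is a reweighting. Hence the transcripts of both runs have densities, `transcriptDensity`, with
respect to one and the same law, that of the erased run (`lintegral_replay_eq_transcriptDensity`);
the hidden indicators are summed out in these densities.

The distance of the two densities `p`, `p'` is measured by the Rényi power `∫ p ^ (k + 1) / p' ^ k`.
As the estimator may remember in which rounds the sample was drawn, the shift in round `t` depends
on the past hidden indicators. Given the past transcript, round `t` is therefore a mixture over the
past indicators; the current one is still independent of them. The Rényi power is jointly convex
(`mixture_pow_mul_inv_pow_le`), so the mixtures may be compared component by component, that is, for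
fixed past indicators in each of the two runs, which need not agree. In this way the power grows by
at most a fixed factor `exp (roundCost q A B k)` in each round (`lintegral_transcriptDensity_le`).

In a single round, let `q = b / m`, let the sample shift the noise by at most `A` through the
minibatch and by at most `B` through the full gradient. The inequality of arithmetic and geometric
means splits the power into two translations, which cost `O(k² B²)`, and moments of order `3 (k + 1)`
and `-3 k` of the likelihood ratios `1 - q + q X`, where `X` is the likelihood ratio of a shift by a
vector of norm at most `A` (`lintegral_roundDensity_le`). Both cost only `O(k² q² A²)` as long as
`k A²` is small. Positive moments follow from a recursion that peels off one factor `1 - q + q X` at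
a time (`mix_recursion_le`). For negative moments (`integral_inv_mixDensity_pow_le`), the comparison
of harmonic and arithmetic mean reduces to the same recursion, with an error term that is
harmless if `k q ≥ 1`; if `k q < 1`, the Taylor expansion of second order suffices.

For `k = ⌈2 log (1 / δ) / ε⌉`, the hypothesis `ε < b² T / m²` makes `k A²` small, and the noise
level makes the total cost of `T + 1` rounds at most `log (1 / δ)` (`exists_order`). Splitting
according to whether `p ≤ exp ε * p'` then gives `(ε, δ)`-privacy (`le_exp_mul_add_of_pow`).
-/

/-! ### Shifts of Gaussian noise -/

namespace SoteriaFL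

open scoped RealInnerProductSpace

variable {d : ℕ}

/-- The density of the law of `z + a` with respect to the law of `z`, for a standard Gaussian
vector `z`. -/
noncomputable def shiftDensity (a z : Vec d) : ℝ := Real.exp (⟪a, z⟫ - ‖a‖ ^ 2 / 2)

theorem shiftDensity_pos (a z : Vec d) : 0 < shiftDensity a z := Real.exp_pos _

theorem continuous_shiftDensity (a : Vec d) : Continuous (shiftDensity a) := by
  unfold shiftDensity
  fun_prop

theorem measurable_shiftDensity {X : Type*} [MeasurableSpace X] {f g : X → Vec d}
    (hf : Measurable f) (hg : Measurable g) : Measurable fun x => shiftDensity (f x) (g x) := by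
  unfold shiftDensity
  fun_prop

theorem map_inner_stdGaussian (a : Vec d) :
    (stdGaussian (Vec d)).map (fun z => ⟪a, z⟫) = gaussianReal 0 (‖a‖ ^ 2).toNNReal := by
  have h := IsGaussian.map_eq_gaussianReal (μ := stdGaussian (Vec d)) (innerSL ℝ a)
  rw [integral_strongDual_stdGaussian, variance_dual_stdGaussian, innerSL_apply_norm] at h
  exact h

theorem integrable_exp_inner (a : Vec d) :
    Integrable (fun z => Real.exp ⟪a, z⟫) (stdGaussian (Vec d)) := by
  have h := integrable_exp_mul_gaussianReal (μ := 0) (v := (‖a‖ ^ 2).toNNReal) 1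
  rw [← map_inner_stdGaussian a] at h
  simpa [Function.comp_def] using h.comp_measurable (f := fun z : Vec d => ⟪a, z⟫) (by fun_prop)

theorem integral_exp_inner (a : Vec d) :
    ∫ z, Real.exp ⟪a, z⟫ ∂(stdGaussian (Vec d)) = Real.exp (‖a‖ ^ 2 / 2) := by
  have h := mgf_gaussianReal (map_inner_stdGaussian a) 1
  simpa [mgf] using h

theorem integrable_shiftDensity (a : Vec d) :
    Integrable (shiftDensity a) (stdGaussian (Vec d)) := by
  simp only [funext (fun z => show shiftDensity a z = _ from Real.exp_sub _ _)]
  exact (integrable_exp_inner a).div_const _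

/-- **Cameron–Martin formula** for the standard Gaussian measure. -/
theorem map_add_stdGaussian (a : Vec d) :
    (stdGaussian (Vec d)).map (fun z => z + a) =
      (stdGaussian (Vec d)).withDensity fun z => ENNReal.ofReal (shiftDensity a z) := by
  have hm : Measurable fun z : Vec d => ENNReal.ofReal (shiftDensity a z) :=
    (continuous_shiftDensity a).measurable.ennreal_ofReal
  have hfin : IsFiniteMeasure
      ((stdGaussian (Vec d)).withDensity fun z => ENNReal.ofReal (shiftDensity a z)) :=
    isFiniteMeasure_withDensity_ofReal (integrable_shiftDensity a).2
  have hprob : IsProbabilityMeasure ((stdGaussian (Vec d)).map (fun z => z + a)) :=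
    Measure.isProbabilityMeasure_map (by fun_prop)
  refine Measure.ext_of_charFun (funext fun t => ?_)
  rw [charFun_map_add_const, charFun_stdGaussian, charFun_apply,
    integral_withDensity_eq_integral_toReal_smul hm
      (Filter.Eventually.of_forall fun _ => ENNReal.ofReal_lt_top)]
  simp only [ENNReal.toReal_ofReal (shiftDensity_pos a _).le]
  rw [← map_pi_eq_stdGaussian, integral_map (by fun_prop) (by
    refine Continuous.aestronglyMeasurable ?_
    unfold shiftDensity
    fun_prop)]
  have key : ∀ x : Fin d → ℝ, shiftDensity a (WithLp.toLp 2 x) •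
      Complex.exp (⟪WithLp.toLp 2 x, t⟫ * Complex.I) =
      Complex.exp (-(‖a‖ : ℂ) ^ 2 / 2) * ∏ i, Complex.exp ((t i * Complex.I + a i) * x i) := by
    intro x
    rw [Complex.real_smul, shiftDensity, Complex.ofReal_exp, ← Complex.exp_sum, ← Complex.exp_add,
      ← Complex.exp_add]
    congr 1
    simp only [PiLp.inner_apply, Complex.ofReal_sub, Complex.ofReal_sum, add_mul,
      Finset.sum_add_distrib, Finset.sum_mul]
    simp only [RCLike.inner_apply, conj_trivial]
    push_cast
    have : ∀ i, (t i : ℂ) * Complex.I * x i = t i * x i * Complex.I := fun i => by ring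
    simp only [this]
    have : ∀ i, (x i : ℂ) * a i = a i * x i := fun i => by ring
    simp only [this]
    ring
  simp only [key]
  rw [integral_const_mul, integral_fintype_prod_eq_prod
    (f := fun i (x : ℝ) => Complex.exp ((t i * Complex.I + a i) * x))]
  have h1 : ∀ i, ∫ x : ℝ, Complex.exp ((t i * Complex.I + a i) * x) ∂(gaussianReal 0 1) =
      Complex.exp ((t i * Complex.I + a i) ^ 2 / 2) := by
    intro i
    have := complexMGF_id_gaussianReal (μ := 0) (v := 1) (t i * Complex.I + a i)
    simpa [complexMGF] using this
  simp only [h1]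
  rw [← Complex.exp_sum, ← Complex.exp_add, ← Complex.exp_add]
  congr 1
  have e1 : ((‖a‖ : ℂ)) ^ 2 = ∑ i, (a i : ℂ) ^ 2 := by
    exact_mod_cast EuclideanSpace.real_norm_sq_eq a
  have e2 : ((‖t‖ : ℂ)) ^ 2 = ∑ i, (t i : ℂ) ^ 2 := by
    exact_mod_cast EuclideanSpace.real_norm_sq_eq t
  have e3 : ∀ i, ((t i : ℂ) * Complex.I + a i) ^ 2 / 2 =
      -(t i : ℂ) ^ 2 / 2 + (a i : ℂ) ^ 2 / 2 + t i * a i * Complex.I := fun i => by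
    ring_nf
    rw [Complex.I_sq]
    ring
  rw [e1, e2]
  simp only [e3, Finset.sum_add_distrib, ← Finset.sum_mul, ← Finset.sum_div,
    Finset.sum_neg_distrib, PiLp.inner_apply]
  simp only [RCLike.inner_apply, conj_trivial]
  push_cast
  ring

/-- A translation of standard Gaussian noise amounts to a reweighting. -/
theorem lintegral_add_stdGaussian (a : Vec d) {f : Vec d → ENNReal} (hf : Measurable f) :
    ∫⁻ z, f (z + a) ∂(stdGaussian (Vec d)) =
      ∫⁻ z, ENNReal.ofReal (shiftDensity a z) * f z ∂(stdGaussian (Vec d)) := by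
  rw [← lintegral_map hf (g := fun z => z + a) (by fun_prop), map_add_stdGaussian,
    lintegral_withDensity_eq_lintegral_mul _
      (continuous_shiftDensity a).measurable.ennreal_ofReal hf]
  rfl

end SoteriaFL

/-! ### Moments of a subsampled likelihood ratio -/

namespace SoteriaFL

open scoped RealInnerProductSpace

variable {d : ℕ}

theorem exp_le_one_add_two_mul {x : ℝ} (h0 : 0 ≤ x) (h1 : x ≤ 1) : Real.exp x ≤ 1 + 2 * x := by
  have h := Real.abs_exp_sub_one_le (x := x) (by rwa [abs_of_nonneg h0])
  rw [abs_of_nonneg h0] at h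
  linarith [le_abs_self (Real.exp x - 1)]

/-- The recursion that peels one factor off a power of `1 - q + q X` turns a bound on the moments
of `X` into one on the moments of `1 - q + q X`; up to the part that comes from `θ`, the logarithm
of the moment gains a factor `q ^ 2`. -/
theorem mix_recursion_le {F : ℕ → ℕ → ℝ} {q v θ : ℝ} (hq0 : 0 ≤ q) (hq1 : q ≤ 1) (hv : 0 ≤ v)
    (hθ : 0 ≤ θ) (h0 : ∀ j : ℕ, F 0 j ≤ Real.exp (v * (j * (j - 1)) / 2 + θ * j))
    (hs : ∀ k j, F (k + 1) j = (1 - q) * F k j + q * F k (j + 1)) (k : ℕ) :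
    ∀ j : ℕ, 2 * v * (k + j) + θ ≤ 1 →
      F k j ≤ Real.exp (v * (j * (j - 1)) / 2 + θ * j + 2 * k * q * (v * j + θ) +
        2 * k ^ 2 * q ^ 2 * v) := by
  induction k with
  | zero =>
    intro j _
    simpa using h0 j
  | succ k ih =>
    intro j hj
    push_cast at hj
    have hj0 : (0 : ℝ) ≤ j := by positivity
    have hk0 : (0 : ℝ) ≤ k := by positivity
    have hvj : 0 ≤ v * j := by positivity
    have hvk : 0 ≤ v * k := by positivity
    have h1 := ih j (by linarith)
    have h2 := ih (j + 1) (by push_cast; linarith)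
    set x : ℝ := v * j + θ + 2 * k * q * v with hx
    set e : ℝ := v * (j * (j - 1)) / 2 + θ * j + 2 * k * q * (v * j + θ) + 2 * k ^ 2 * q ^ 2 * v
      with he
    have hkqv : k * q * v ≤ v * k := by nlinarith
    have hx0 : 0 ≤ x := by positivity
    have hx1 : x ≤ 1 := by linarith
    rw [show v * (((j + 1 : ℕ) : ℝ) * (((j + 1 : ℕ) : ℝ) - 1)) / 2 + θ * ((j + 1 : ℕ) : ℝ) +
      2 * k * q * (v * ((j + 1 : ℕ) : ℝ) + θ) + 2 * k ^ 2 * q ^ 2 * v = e + x by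
        rw [hx, he]; push_cast; ring, Real.exp_add] at h2
    calc F (k + 1) j = (1 - q) * F k j + q * F k (j + 1) := hs k j
      _ ≤ (1 - q) * Real.exp e + q * (Real.exp e * Real.exp x) := by
          have := sub_nonneg.2 hq1
          gcongr
      _ = Real.exp e * (q * (Real.exp x - 1) + 1) := by ring
      _ ≤ Real.exp e * (q * (2 * x) + 1) := by
          gcongr
          linarith [exp_le_one_add_two_mul hx0 hx1]
      _ ≤ Real.exp e * Real.exp (q * (2 * x)) := by
          gcongr
          exact Real.add_one_le_exp _
      _ ≤ _ := by
          rw [← Real.exp_add]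
          refine Real.exp_le_exp.2 ?_
          have : 0 ≤ q ^ 2 * v := by positivity
          rw [hx, he]
          push_cast
          nlinarith

section Mixture

variable {Ω : Type*} [MeasurableSpace Ω] {μ : Measure Ω} {X : Ω → ℝ} {q : ℝ}

theorem integrable_mix_pow (h : ∀ j : ℕ, Integrable (fun z => X z ^ j) μ) (k : ℕ) :
    ∀ j : ℕ, Integrable (fun z => (1 - q + q * X z) ^ k * X z ^ j) μ := by
  induction k with
  | zero => simpa using h
  | succ k ih =>
    intro j
    refine (((ih j).const_mul (1 - q)).add ((ih (j + 1)).const_mul q)).congr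
      (Filter.Eventually.of_forall fun z => ?_)
    simp only [Pi.add_apply]
    ring

/-- The moments of `1 - q + q X`, if those of `X` are at most the moments of the likelihood ratio of
a Gaussian shift of squared norm `v`, up to the factor `exp (θ j)`. -/
theorem integral_mix_pow_le {v θ : ℝ} (hq0 : 0 ≤ q) (hq1 : q ≤ 1) (hv : 0 ≤ v) (hθ : 0 ≤ θ)
    (h : ∀ j : ℕ, Integrable (fun z => X z ^ j) μ)
    (hX : ∀ j : ℕ, ∫ z, X z ^ j ∂μ ≤ Real.exp (v * (j * (j - 1)) / 2 + θ * j))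
    {k : ℕ} (hk : 2 * v * k + θ ≤ 1) :
    ∫ z, (1 - q + q * X z) ^ k ∂μ ≤ Real.exp (2 * k * q * θ + 2 * k ^ 2 * q ^ 2 * v) := by
  have := mix_recursion_le (F := fun k j => ∫ z, (1 - q + q * X z) ^ k * X z ^ j ∂μ)
    hq0 hq1 hv hθ (by simpa using hX) (fun k j => by
      rw [← integral_const_mul, ← integral_const_mul, ← integral_add
        ((integrable_mix_pow h k j).const_mul _) ((integrable_mix_pow h k (j + 1)).const_mul _)]
      congr 1 with z
      ring) k 0 (by simpa using hk)
  simpa using this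

end Mixture

theorem shiftDensity_zpow (a z : Vec d) (j : ℤ) :
    shiftDensity a z ^ j = Real.exp ⟪(j : ℝ) • a, z⟫ * Real.exp (-(j * ‖a‖ ^ 2 / 2)) := by
  rw [shiftDensity, ← Real.rpow_intCast, ← Real.exp_mul, ← Real.exp_add, real_inner_smul_left]
  congr 1
  ring

theorem integrable_shiftDensity_zpow (a : Vec d) (j : ℤ) :
    Integrable (fun z => shiftDensity a z ^ j) (stdGaussian (Vec d)) := by
  simp only [shiftDensity_zpow]
  exact (integrable_exp_inner _).mul_const _

theorem integral_shiftDensity_zpow (a : Vec d) (j : ℤ) :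
    ∫ z, shiftDensity a z ^ j ∂(stdGaussian (Vec d)) =
      Real.exp (‖a‖ ^ 2 * (j * (j - 1)) / 2) := by
  simp only [shiftDensity_zpow]
  rw [integral_mul_const, integral_exp_inner, norm_smul, ← Real.exp_add, mul_pow,
    Real.norm_eq_abs, sq_abs]
  congr 1
  ring

theorem integrable_shiftDensity_pow (a : Vec d) (j : ℕ) :
    Integrable (fun z => shiftDensity a z ^ j) (stdGaussian (Vec d)) :=
  mod_cast integrable_shiftDensity_zpow a j

theorem integral_shiftDensity_pow (a : Vec d) (j : ℕ) :
    ∫ z, shiftDensity a z ^ j ∂(stdGaussian (Vec d)) =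
      Real.exp (‖a‖ ^ 2 * (j * (j - 1)) / 2) :=
  mod_cast integral_shiftDensity_zpow a j

theorem integrable_inv_shiftDensity_pow (a : Vec d) (j : ℕ) :
    Integrable (fun z => (shiftDensity a z)⁻¹ ^ j) (stdGaussian (Vec d)) := by
  simpa using integrable_shiftDensity_zpow a (-j)

theorem integral_inv_shiftDensity_pow (a : Vec d) (j : ℕ) :
    ∫ z, (shiftDensity a z)⁻¹ ^ j ∂(stdGaussian (Vec d)) =
      Real.exp (‖a‖ ^ 2 * (j * (j - 1)) / 2 + ‖a‖ ^ 2 * j) := by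
  have h := integral_shiftDensity_zpow a (-j)
  simp only [zpow_neg, zpow_natCast, ← inv_pow] at h
  rw [h]
  congr 1
  push_cast
  ring

/-- The density of the noise of one round in which the sample, with gradient `a`, is drawn with
probability `q`. -/
noncomputable def mixDensity (q : ℝ) (a z : Vec d) : ℝ := 1 - q + q * shiftDensity a z

theorem mixDensity_pos {q : ℝ} (hq0 : 0 ≤ q) (hq1 : q ≤ 1) (a z : Vec d) :
    0 < mixDensity q a z := by
  have h := shiftDensity_pos a z
  unfold mixDensity
  rcases hq0.eq_or_lt with rfl | hq
  · simp
  · have := mul_pos hq h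
    linarith

theorem measurable_mixDensity (q : ℝ) (a : Vec d) : Measurable (mixDensity q a) := by
  have := (continuous_shiftDensity a).measurable
  unfold mixDensity
  fun_prop

theorem integrable_mixDensity_pow (q : ℝ) (a : Vec d) (k : ℕ) :
    Integrable (fun z => mixDensity q a z ^ k) (stdGaussian (Vec d)) := by
  simpa [mixDensity] using
    integrable_mix_pow (q := q) (integrable_shiftDensity_pow a) k 0

theorem integral_mixDensity_pow_le {q : ℝ} (hq0 : 0 ≤ q) (hq1 : q ≤ 1) (a : Vec d) {k : ℕ}
    (hk : 2 * k * ‖a‖ ^ 2 ≤ 1) :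
    ∫ z, mixDensity q a z ^ k ∂(stdGaussian (Vec d)) ≤
      Real.exp (2 * k ^ 2 * q ^ 2 * ‖a‖ ^ 2) := by
  have := integral_mix_pow_le (θ := 0) hq0 hq1 (sq_nonneg ‖a‖) le_rfl
    (integrable_shiftDensity_pow a) (fun j => by
      rw [integral_shiftDensity_pow]; simp) (k := k) (by linarith)
  simpa [mixDensity] using this

/-! ### Inverse moments of a subsampled likelihood ratio -/

/-- The harmonic mean is at most the arithmetic mean. -/
theorem inv_mix_le {q y : ℝ} (hq0 : 0 ≤ q) (hq1 : q ≤ 1) (hy : 0 < y) :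
    (1 - q + q * y)⁻¹ ≤ 1 - q + q * y⁻¹ := by
  have hu : 0 < 1 - q + q * y := by
    rcases hq0.eq_or_lt with rfl | hq
    · simp
    · have := mul_pos hq hy
      linarith
  rw [inv_le_iff_one_le_mul₀ hu]
  have h : (1 - q + q * y⁻¹) * (1 - q + q * y) = 1 + q * (1 - q) * ((y - 1) ^ 2 * y⁻¹) := by
    field_simp
    ring
  rw [h]
  have : 0 ≤ q * (1 - q) * ((y - 1) ^ 2 * y⁻¹) := by
    have := sub_nonneg.2 hq1
    positivity
  linarith

/-- Second order Taylor expansion of `u ↦ u⁻¹ ^ k` at `1`. The supremum of the second derivative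
between `u` and `1` is controlled by the sum of the values at both ends. -/
theorem inv_pow_le_taylor {u : ℝ} (hu : 0 < u) (k : ℕ) :
    u⁻¹ ^ k ≤ 1 - k * (u - 1) + k ^ 2 * (u - 1) ^ 2 * (1 + u⁻¹ ^ k) := by
  have hone : ∀ i ≤ k, u⁻¹ ^ i ≤ 1 + u⁻¹ ^ k := by
    intro i hi
    have h0 : 0 < u⁻¹ := inv_pos.2 hu
    rcases le_total u⁻¹ 1 with h | h
    · exact (pow_le_one₀ h0.le h).trans (by linarith [pow_pos h0 k])
    · exact (pow_le_pow_right₀ h hi).trans (by linarith)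
  have hM : 0 ≤ 1 + u⁻¹ ^ k := by positivity
  set M := 1 + u⁻¹ ^ k
  have hlin : ∀ i ≤ k, (1 - u⁻¹ ^ i) * (u - 1) ≤ i * (u - 1) ^ 2 * M := by
    intro i
    induction i with
    | zero => simp
    | succ i ih =>
      intro hi
      have h1 := ih (by omega)
      have h2 := mul_le_mul_of_nonneg_left (hone (i + 1) hi) (sq_nonneg (u - 1))
      have h3 : (1 - u⁻¹ ^ (i + 1)) * (u - 1) =
          (1 - u⁻¹ ^ i) * (u - 1) + (u - 1) ^ 2 * u⁻¹ ^ (i + 1) := by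
        rw [pow_succ]
        field_simp
        ring
      push_cast
      linarith
  have hquad : ∀ i ≤ k, u⁻¹ ^ i - 1 + i * (u - 1) ≤ i * (k * ((u - 1) ^ 2 * M)) := by
    intro i
    induction i with
    | zero => simp
    | succ i ih =>
      intro hi
      have h1 := ih (by omega)
      have h2 := hlin (i + 1) hi
      have h3 : u⁻¹ ^ (i + 1) = u⁻¹ ^ i - (u - 1) * u⁻¹ ^ (i + 1) := by
        rw [pow_succ]
        field_simp
        ring
      have h4 : ((i + 1 : ℕ) : ℝ) * ((u - 1) ^ 2 * M) ≤ k * ((u - 1) ^ 2 * M) := by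
        gcongr
      push_cast at h2 h4 ⊢
      linarith
  have := hquad k le_rfl
  linarith

theorem integrable_inv_mixDensity_pow {q : ℝ} (hq0 : 0 ≤ q) (hq1 : q ≤ 1) (a : Vec d) (k : ℕ) :
    Integrable (fun z => (mixDensity q a z)⁻¹ ^ k) (stdGaussian (Vec d)) := by
  have h := integrable_mix_pow (q := q) (integrable_inv_shiftDensity_pow a) k 0
  refine h.mono' ((measurable_mixDensity q a).inv.pow_const k).aestronglyMeasurable
    (Filter.Eventually.of_forall fun z => ?_)
  have := inv_mix_le hq0 hq1 (shiftDensity_pos a z)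
  have h0 := inv_pos.2 (mixDensity_pos hq0 hq1 a z)
  rw [Real.norm_of_nonneg (by positivity), pow_zero, mul_one]
  exact pow_le_pow_left₀ h0.le this k

theorem integral_mix_inv_pow_le {q : ℝ} (hq0 : 0 ≤ q) (hq1 : q ≤ 1) (a : Vec d) {k : ℕ}
    (hk : (2 * k + 1) * ‖a‖ ^ 2 ≤ 1) :
    ∫ z, (1 - q + q * (shiftDensity a z)⁻¹) ^ k ∂(stdGaussian (Vec d)) ≤
      Real.exp (2 * k * q * ‖a‖ ^ 2 + 2 * k ^ 2 * q ^ 2 * ‖a‖ ^ 2) :=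
  integral_mix_pow_le hq0 hq1 (sq_nonneg ‖a‖) (sq_nonneg ‖a‖)
    (integrable_inv_shiftDensity_pow a) (fun j => (integral_inv_shiftDensity_pow a j).le)
    (by linarith)

theorem shiftDensity_sub_one_pow (a z : Vec d) (k : ℕ) :
    (shiftDensity a z - 1) ^ k =
      ∑ j ∈ Finset.range (k + 1), (-1) ^ (k - j) * k.choose j * shiftDensity a z ^ j := by
  rw [sub_eq_add_neg, add_pow]
  exact Finset.sum_congr rfl fun j _ => by ring

theorem integrable_shiftDensity_sub_one_pow (a : Vec d) (k : ℕ) :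
    Integrable (fun z => (shiftDensity a z - 1) ^ k) (stdGaussian (Vec d)) := by
  simp only [shiftDensity_sub_one_pow]
  exact integrable_finsetSum _ fun j _ => (integrable_shiftDensity_pow a j).const_mul _

theorem integral_shiftDensity_sub_one_pow (a : Vec d) (k : ℕ) :
    ∫ z, (shiftDensity a z - 1) ^ k ∂(stdGaussian (Vec d)) =
      ∑ j ∈ Finset.range (k + 1),
        (-1) ^ (k - j) * k.choose j * Real.exp (‖a‖ ^ 2 * (j * (j - 1)) / 2) := by
  simp only [shiftDensity_sub_one_pow]
  rw [integral_finsetSum _ fun j _ => (integrable_shiftDensity_pow a j).const_mul _]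
  simp only [integral_const_mul, integral_shiftDensity_pow]

theorem integral_shiftDensity_sub_one_sq_le {a : Vec d} (ha : 6 * ‖a‖ ^ 2 ≤ 1) :
    ∫ z, (shiftDensity a z - 1) ^ 2 ∂(stdGaussian (Vec d)) ≤ 2 * ‖a‖ ^ 2 := by
  have h := exp_le_one_add_two_mul (sq_nonneg ‖a‖) (by linarith [sq_nonneg ‖a‖])
  rw [integral_shiftDensity_sub_one_pow]
  norm_num [Finset.sum_range_succ]
  linarith

theorem integral_shiftDensity_sub_one_pow_four_le {a : Vec d} (ha : 6 * ‖a‖ ^ 2 ≤ 1) :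
    ∫ z, (shiftDensity a z - 1) ^ 4 ∂(stdGaussian (Vec d)) ≤ 42 * (‖a‖ ^ 2) ^ 2 := by
  have hv := sq_nonneg ‖a‖
  have hu := exp_le_one_add_two_mul hv (by linarith)
  have hu1 : 1 ≤ Real.exp (‖a‖ ^ 2) := Real.one_le_exp hv
  have e1 : Real.exp (‖a‖ ^ 2 * 12 / 2) = Real.exp (‖a‖ ^ 2) ^ 6 := by
    rw [← Real.exp_nat_mul]; congr 1; push_cast; ring
  have e2 : Real.exp (‖a‖ ^ 2 * 6 / 2) = Real.exp (‖a‖ ^ 2) ^ 3 := by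
    rw [← Real.exp_nat_mul]; congr 1; push_cast; ring
  rw [integral_shiftDensity_sub_one_pow]
  norm_num [Finset.sum_range_succ, Nat.choose, e1, e2]
  set u := Real.exp (‖a‖ ^ 2)
  have h43 : u ≤ 4 / 3 := by linarith
  have h2 : u ^ 2 ≤ (4 / 3) ^ 2 := by gcongr
  have h3 : u ^ 3 ≤ (4 / 3) ^ 3 := by gcongr
  have h4 : u ^ 4 ≤ (4 / 3) ^ 4 := by gcongr
  have hsq : (u - 1) ^ 2 ≤ (2 * ‖a‖ ^ 2) ^ 2 := by
    have : 0 ≤ u - 1 := by linarith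
    gcongr
    linarith
  -- the polynomial has the double root `u = 1`
  calc _ = (u - 1) ^ 2 * (u ^ 4 + 2 * u ^ 3 + 3 * u ^ 2 - 3) := by ring
    _ ≤ (u - 1) ^ 2 * (42 / 4) := by
        gcongr
        norm_num at h2 h3 h4
        linarith
    _ ≤ (2 * ‖a‖ ^ 2) ^ 2 * (42 / 4) := by gcongr
    _ = _ := by ring

/-- The inverse moments of a subsampled likelihood ratio.  While the harmonic-arithmetic mean
inequality loses the factor `q ^ 2` when `k * q` is small, a Taylor expansion of second order is
good enough in this case. -/
theorem integral_inv_mixDensity_pow_le {q : ℝ} (hq0 : 0 ≤ q) (hq1 : q ≤ 1) (a : Vec d) {k : ℕ}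
    (hk1 : 1 ≤ k) (hk : 6 * k * ‖a‖ ^ 2 ≤ 1) :
    ∫ z, (mixDensity q a z)⁻¹ ^ k ∂(stdGaussian (Vec d)) ≤
      Real.exp (30 * k ^ 2 * q ^ 2 * ‖a‖ ^ 2) := by
  have hk1' : (1 : ℝ) ≤ k := by exact_mod_cast hk1
  have hv0 := sq_nonneg ‖a‖
  have hv : ‖a‖ ^ 2 ≤ k * ‖a‖ ^ 2 := by nlinarith
  have hva : 6 * ‖a‖ ^ 2 ≤ 1 := by linarith
  have hle : ∀ z : Vec d, (mixDensity q a z)⁻¹ ≤ 1 - q + q * (shiftDensity a z)⁻¹ :=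
    fun z => inv_mix_le hq0 hq1 (shiftDensity_pos a z)
  have hpos : ∀ z : Vec d, 0 < (mixDensity q a z)⁻¹ :=
    fun z => inv_pos.2 (mixDensity_pos hq0 hq1 a z)
  have hH : ∀ l : ℕ, Integrable (fun z => (1 - q + q * (shiftDensity a z)⁻¹) ^ l)
      (stdGaussian (Vec d)) := fun l => by
    simpa using integrable_mix_pow (q := q) (integrable_inv_shiftDensity_pow a) l 0
  have hkq0 : 0 ≤ k * q := by positivity
  rcases le_total 1 (k * q) with hkq | hkq
  · calc _ ≤ ∫ z, (1 - q + q * (shiftDensity a z)⁻¹) ^ k ∂(stdGaussian (Vec d)) :=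
          integral_mono (integrable_inv_mixDensity_pow hq0 hq1 a k) (hH k)
            fun z => pow_le_pow_left₀ (hpos z).le (hle z) k
      _ ≤ _ := integral_mix_inv_pow_le hq0 hq1 a (by linarith)
      _ ≤ _ := by
          refine Real.exp_le_exp.2 ?_
          have : k * q * ‖a‖ ^ 2 ≤ (k * q) ^ 2 * ‖a‖ ^ 2 := by
            gcongr
            nlinarith
          nlinarith
  rcases hv0.eq_or_lt with h0 | hvpos
  · have : a = 0 := by simpa using h0.symm
    simp [this, mixDensity, shiftDensity]
  have hH2 : ∫ z, (1 - q + q * (shiftDensity a z)⁻¹) ^ (2 * k) ∂(stdGaussian (Vec d)) ≤ 10 := by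
    refine (integral_mix_inv_pow_le hq0 hq1 a (by push_cast; linarith)).trans ?_
    have h1 : k * q * ‖a‖ ^ 2 ≤ 1 / 6 := by nlinarith
    have h2 : (k * q) ^ 2 * ‖a‖ ^ 2 ≤ 1 / 6 := by nlinarith
    have h3 : Real.exp 2 ≤ 10 := by
      have := Real.exp_one_lt_d9
      rw [show (2 : ℝ) = 1 + 1 by norm_num, Real.exp_add]
      nlinarith [Real.exp_pos 1]
    refine (Real.exp_le_exp.2 ?_).trans h3
    push_cast
    nlinarith
  set v := ‖a‖ ^ 2 with hvdef
  have hbound : ∀ z : Vec d, (mixDensity q a z)⁻¹ ^ k ≤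
      1 - k * q * (shiftDensity a z - 1) ^ 1 + (k * q) ^ 2 * ((shiftDensity a z - 1) ^ 2 +
        ((2 * v)⁻¹ * (shiftDensity a z - 1) ^ 4 +
          v / 2 * (1 - q + q * (shiftDensity a z)⁻¹) ^ (2 * k))) := by
    intro z
    have h1 := inv_pow_le_taylor (mixDensity_pos hq0 hq1 a z) k
    have h2 := pow_le_pow_left₀ (hpos z).le (hle z) k
    set W := shiftDensity a z - 1 with hW
    set H := 1 - q + q * (shiftDensity a z)⁻¹
    have h3 : mixDensity q a z - 1 = q * W := by rw [mixDensity, hW]; ring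
    -- weighted so that `W ^ 4`, of mean `O(v ^ 2)`, balances `H ^ (2 * k)`, of mean `O(1)`
    have h4 : W ^ 2 * H ^ k ≤ (2 * v)⁻¹ * W ^ 4 + v / 2 * H ^ (2 * k) := by
      have : (2 * v)⁻¹ * W ^ 4 + v / 2 * H ^ (2 * k) - W ^ 2 * H ^ k =
          (2 * v)⁻¹ * (W ^ 2 - v * H ^ k) ^ 2 := by
        field_simp
        ring
      have : 0 ≤ (2 * v)⁻¹ * (W ^ 2 - v * H ^ k) ^ 2 := by positivity
      linarith
    rw [h3] at h1
    calc _ ≤ _ := h1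
      _ = 1 - k * q * W ^ 1 + (k * q) ^ 2 * (W ^ 2 + W ^ 2 * (mixDensity q a z)⁻¹ ^ k) := by ring
      _ ≤ 1 - k * q * W ^ 1 + (k * q) ^ 2 * (W ^ 2 + W ^ 2 * H ^ k) := by gcongr
      _ ≤ _ := by gcongr
  have i1 := integrable_shiftDensity_sub_one_pow a 1
  have i2 := integrable_shiftDensity_sub_one_pow a 2
  have i3 : Integrable (fun z => (2 * v)⁻¹ * (shiftDensity a z - 1) ^ 4) (stdGaussian (Vec d)) :=
    (integrable_shiftDensity_sub_one_pow a 4).const_mul _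
  have i4 : Integrable (fun z => v / 2 * (1 - q + q * (shiftDensity a z)⁻¹) ^ (2 * k))
      (stdGaussian (Vec d)) := (hH (2 * k)).const_mul _
  have i34 : Integrable (fun z => (2 * v)⁻¹ * (shiftDensity a z - 1) ^ 4 +
      v / 2 * (1 - q + q * (shiftDensity a z)⁻¹) ^ (2 * k)) (stdGaussian (Vec d)) := i3.add i4
  have i5 : Integrable (fun z => 1 - k * q * (shiftDensity a z - 1) ^ 1) (stdGaussian (Vec d)) :=
    (integrable_const 1).sub (i1.const_mul _)
  have i6 : Integrable (fun z => (k * q) ^ 2 * ((shiftDensity a z - 1) ^ 2 +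
      ((2 * v)⁻¹ * (shiftDensity a z - 1) ^ 4 +
        v / 2 * (1 - q + q * (shiftDensity a z)⁻¹) ^ (2 * k)))) (stdGaussian (Vec d)) :=
    (i2.add i34).const_mul _
  refine (integral_mono (integrable_inv_mixDensity_pow hq0 hq1 a k) (i5.add i6) hbound).trans ?_
  have e1 : ∫ z, (shiftDensity a z - 1) ^ 1 ∂(stdGaussian (Vec d)) = 0 := by
    rw [integral_shiftDensity_sub_one_pow]
    simp [Finset.sum_range_succ]
  have e2 := integral_shiftDensity_sub_one_sq_le hva
  have e3 := integral_shiftDensity_sub_one_pow_four_le hva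
  rw [integral_add' i5 i6, integral_sub (integrable_const _) (i1.const_mul _), integral_const_mul,
    integral_const_mul, integral_add i2 i34, integral_add i3 i4, integral_const_mul,
    integral_const_mul, e1]
  have e4 : (2 * v)⁻¹ * ∫ z, (shiftDensity a z - 1) ^ 4 ∂(stdGaussian (Vec d)) ≤ 21 * v := by
    calc _ ≤ (2 * v)⁻¹ * (42 * v ^ 2) := by gcongr
      _ = _ := by field_simp; norm_num
  calc _ ≤ 1 - k * q * 0 + (k * q) ^ 2 * (2 * v + (21 * v + v / 2 * 10)) := by
        simp only [integral_const, probReal_univ, smul_eq_mul, mul_one]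
        gcongr
    _ ≤ 30 * k ^ 2 * q ^ 2 * v + 1 := by
        have : 0 ≤ (k * q) ^ 2 * v := by positivity
        nlinarith
    _ ≤ _ := Real.add_one_le_exp _

end SoteriaFL

/-! ### One round of the subsampled Gaussian mechanism -/

namespace SoteriaFL

open scoped RealInnerProductSpace

variable {d : ℕ}

/-- The density, with respect to standard Gaussian noise, of noise that is shifted by `b`, and
with probability `q` by `a` in addition. -/
noncomputable def roundDensity (q : ℝ) (a b z : Vec d) : ℝ :=
  q * shiftDensity (a + b) z + (1 - q) * shiftDensity b z

theorem roundDensity_eq (q : ℝ) (a b z : Vec d) :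
    roundDensity q a b z = shiftDensity b z * mixDensity q a (z - b) := by
  have h : shiftDensity (a + b) z = shiftDensity b z * shiftDensity a (z - b) := by
    simp only [shiftDensity]
    rw [← Real.exp_add, inner_add_left, inner_sub_right, norm_add_sq_real]
    congr 1
    ring
  rw [roundDensity, mixDensity, h]
  ring

theorem roundDensity_pos {q : ℝ} (hq0 : 0 ≤ q) (hq1 : q ≤ 1) (a b z : Vec d) :
    0 < roundDensity q a b z := by
  rw [roundDensity_eq]
  exact mul_pos (shiftDensity_pos _ _) (mixDensity_pos hq0 hq1 _ _)

theorem measurable_roundDensity (q : ℝ) (a b : Vec d) : Measurable (roundDensity q a b) := by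
  have h1 := (continuous_shiftDensity (a + b)).measurable
  have h2 := (continuous_shiftDensity b).measurable
  unfold roundDensity
  fun_prop

theorem lintegral_shiftDensity_mul_comp_sub (b : Vec d) {f : Vec d → ℝ} (hf : Measurable f) :
    ∫⁻ z, ENNReal.ofReal (shiftDensity b z * f (z - b)) ∂(stdGaussian (Vec d)) =
      ∫⁻ z, ENNReal.ofReal (f z) ∂(stdGaussian (Vec d)) := by
  have h := lintegral_add_stdGaussian b (f := fun z => ENNReal.ofReal (f (z - b)))
    (hf.comp (measurable_id.sub_const b)).ennreal_ofReal
  simp only [add_sub_cancel_right] at h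
  rw [h]
  simp only [ENNReal.ofReal_mul (shiftDensity_pos b _).le]

theorem lintegral_ofReal_le {Ω : Type*} [MeasurableSpace Ω] {μ : Measure Ω} {f : Ω → ℝ} {c : ℝ}
    (hf : Integrable f μ) (h0 : ∀ z, 0 ≤ f z) (h : ∫ z, f z ∂μ ≤ c) :
    ∫⁻ z, ENNReal.ofReal (f z) ∂μ ≤ ENNReal.ofReal c := by
  rw [← ofReal_integral_eq_lintegral_ofReal hf (Filter.Eventually.of_forall h0)]
  exact ENNReal.ofReal_le_ofReal h

theorem lintegral_shiftDensity_pow_mul_inv_pow (b b' : Vec d) (k : ℕ) :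
    ∫⁻ z, ENNReal.ofReal (shiftDensity b z ^ (k + 1) * (shiftDensity b' z)⁻¹ ^ k)
        ∂(stdGaussian (Vec d)) =
      ENNReal.ofReal (Real.exp ((k + 1) * k * ‖b - b'‖ ^ 2 / 2)) := by
  have h : ∀ z, shiftDensity b z ^ (k + 1) * (shiftDensity b' z)⁻¹ ^ k =
      Real.exp ⟪((k : ℝ) + 1) • b - (k : ℝ) • b', z⟫ *
        Real.exp (-((k + 1) * (‖b‖ ^ 2 / 2)) + k * (‖b'‖ ^ 2 / 2)) := by
    intro z
    simp only [shiftDensity]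
    rw [← Real.exp_neg, ← Real.exp_nat_mul, ← Real.exp_nat_mul, ← Real.exp_add, ← Real.exp_add,
      inner_sub_left, real_inner_smul_left, real_inner_smul_left]
    congr 1
    push_cast
    ring
  simp only [h]
  rw [← ofReal_integral_eq_lintegral_ofReal ((integrable_exp_inner _).mul_const _)
    (Filter.Eventually.of_forall fun _ => by positivity), integral_mul_const, integral_exp_inner,
    ← Real.exp_add, norm_sub_sq_real, norm_sub_sq_real, norm_smul, norm_smul,
    real_inner_smul_left, real_inner_smul_right, mul_pow, mul_pow, Real.norm_eq_abs,
    Real.norm_eq_abs, sq_abs, sq_abs]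
  congr 2
  ring

/-- The inequality of arithmetic and geometric means for three numbers, with geometric mean `s`. -/
theorem le_of_pow_three_eq {s x y z : ℝ} (hx : 0 ≤ x) (hy : 0 ≤ y) (hz : 0 ≤ z)
    (h : s ^ 3 = x * y * z) : s ≤ (x + y + z) / 3 := by
  refine le_of_pow_le_pow_left₀ three_ne_zero (by positivity) ?_
  rw [h]
  nlinarith [mul_nonneg hx (sq_nonneg (y - z)), mul_nonneg hy (sq_nonneg (x - z)),
    mul_nonneg hz (sq_nonneg (x - y)), mul_nonneg (add_nonneg (add_nonneg hx hy) hz)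
    (add_nonneg (add_nonneg (sq_nonneg (x - y)) (sq_nonneg (y - z))) (sq_nonneg (x - z)))]

/-- The Rényi cost of one round: two runs whose samples contribute at most `A` through the
minibatch and at most `B` through the full gradient. -/
noncomputable def roundCost (q A B : ℝ) (k : ℕ) : ℝ :=
  270 * ((k : ℝ) + 1) ^ 2 * (q ^ 2 * A ^ 2 + B ^ 2)

/-- A bound on the Rényi divergence between two rounds.  By the inequality of arithmetic and
geometric means, the two mixtures and the two translations are treated separately. -/
theorem lintegral_roundDensity_le {q A B : ℝ} (hq0 : 0 ≤ q) (hq1 : q ≤ 1) {k : ℕ} (hk : 1 ≤ k)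
    (hA : 18 * ((k : ℝ) + 1) * A ^ 2 ≤ 1) {a b a' b' : Vec d}
    (ha : ‖a‖ ≤ A) (hb : ‖b‖ ≤ B) (ha' : ‖a'‖ ≤ A) (hb' : ‖b'‖ ≤ B) :
    ∫⁻ z, ENNReal.ofReal (roundDensity q a b z ^ (k + 1) * (roundDensity q a' b' z)⁻¹ ^ k)
        ∂(stdGaussian (Vec d)) ≤ ENNReal.ofReal (Real.exp (roundCost q A B k)) := by
  have hk1 : (1 : ℝ) ≤ k := by exact_mod_cast hk
  have haA : ‖a‖ ^ 2 ≤ A ^ 2 := by gcongr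
  have haA' : ‖a'‖ ^ 2 ≤ A ^ 2 := by gcongr
  have hA0 : 0 ≤ A ^ 2 := sq_nonneg A
  have hka : ((k : ℝ) + 1) * ‖a‖ ^ 2 ≤ (k + 1) * A ^ 2 := by gcongr
  have hka' : (k : ℝ) * ‖a'‖ ^ 2 ≤ k * A ^ 2 := by gcongr
  have hqA : 0 ≤ q ^ 2 * A ^ 2 := by positivity
  set c := roundCost q A B k with hc
  have h1 : ∫⁻ z, ENNReal.ofReal
      (shiftDensity b z * mixDensity q a (z - b) ^ (3 * (k + 1))) ∂(stdGaussian (Vec d)) ≤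
        ENNReal.ofReal (Real.exp c) := by
    rw [lintegral_shiftDensity_mul_comp_sub b
      (f := fun z => mixDensity q a z ^ (3 * (k + 1))) ((measurable_mixDensity q a).pow_const _)]
    refine lintegral_ofReal_le (integrable_mixDensity_pow q a _)
      (fun z => pow_nonneg (mixDensity_pos hq0 hq1 a z).le _)
      ((integral_mixDensity_pow_le hq0 hq1 a ?_).trans (Real.exp_le_exp.2 ?_))
    · push_cast
      linarith [sq_nonneg ‖a‖]
    · rw [hc, roundCost]
      push_cast
      calc _ = 18 * ((k : ℝ) + 1) ^ 2 * (q ^ 2 * ‖a‖ ^ 2 + 0) := by ring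
        _ ≤ _ := by
          gcongr
          · norm_num
          · positivity
  have h2 : ∫⁻ z, ENNReal.ofReal
      (shiftDensity b' z * (mixDensity q a' (z - b'))⁻¹ ^ (3 * k)) ∂(stdGaussian (Vec d)) ≤
        ENNReal.ofReal (Real.exp c) := by
    rw [lintegral_shiftDensity_mul_comp_sub b'
      (f := fun z => (mixDensity q a' z)⁻¹ ^ (3 * k)) ((measurable_mixDensity q a').inv.pow_const _)]
    refine lintegral_ofReal_le (integrable_inv_mixDensity_pow hq0 hq1 a' _)
      (fun z => pow_nonneg (inv_pos.2 (mixDensity_pos hq0 hq1 a' z)).le _)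
      ((integral_inv_mixDensity_pow_le hq0 hq1 a' (by omega) ?_).trans (Real.exp_le_exp.2 ?_))
    · push_cast
      linarith
    · rw [hc, roundCost]
      push_cast
      calc _ = 270 * (k : ℝ) ^ 2 * (q ^ 2 * ‖a'‖ ^ 2 + 0) := by ring
        _ ≤ _ := by
          gcongr
          · linarith
          · positivity
  have h3 : ∫⁻ z, ENNReal.ofReal
      (shiftDensity b z ^ (3 * k + 1 + 1) * (shiftDensity b' z)⁻¹ ^ (3 * k + 1))
        ∂(stdGaussian (Vec d)) ≤ ENNReal.ofReal (Real.exp c) := by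
    rw [lintegral_shiftDensity_pow_mul_inv_pow]
    refine ENNReal.ofReal_le_ofReal (Real.exp_le_exp.2 ?_)
    have hbb : ‖b - b'‖ ≤ 2 * B := (norm_sub_le _ _).trans (by linarith)
    have hbb2 : ‖b - b'‖ ^ 2 ≤ (2 * B) ^ 2 := by gcongr
    have hkk : (((3 * k + 1 : ℕ) : ℝ) + 1) * ((3 * k + 1 : ℕ) : ℝ) ≤ 9 * ((k : ℝ) + 1) ^ 2 := by
      push_cast
      nlinarith
    calc _ ≤ 9 * ((k : ℝ) + 1) ^ 2 * (2 * B) ^ 2 / 2 := by gcongr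
      _ ≤ _ := by
          rw [hc, roundCost]
          have : 0 ≤ ((k : ℝ) + 1) ^ 2 * B ^ 2 := by positivity
          have : 0 ≤ ((k : ℝ) + 1) ^ 2 * (q ^ 2 * A ^ 2) := by positivity
          nlinarith
  have hpt : ∀ z, ENNReal.ofReal
      (roundDensity q a b z ^ (k + 1) * (roundDensity q a' b' z)⁻¹ ^ k) ≤
      ENNReal.ofReal (1 / 3) * (ENNReal.ofReal
        (shiftDensity b z * mixDensity q a (z - b) ^ (3 * (k + 1))) + (ENNReal.ofReal
        (shiftDensity b' z * (mixDensity q a' (z - b'))⁻¹ ^ (3 * k)) + ENNReal.ofReal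
        (shiftDensity b z ^ (3 * k + 1 + 1) * (shiftDensity b' z)⁻¹ ^ (3 * k + 1)))) := by
    intro z
    have p1 := shiftDensity_pos b z
    have p2 := shiftDensity_pos b' z
    have p3 := mixDensity_pos hq0 hq1 a (z - b)
    have p4 := mixDensity_pos hq0 hq1 a' (z - b')
    rw [← ENNReal.ofReal_add (by positivity) (by positivity),
      ← ENNReal.ofReal_add (by positivity) (by positivity), ← ENNReal.ofReal_mul (by norm_num)]
    refine ENNReal.ofReal_le_ofReal ?_
    rw [roundDensity_eq, roundDensity_eq]
    rw [show ∀ x y w : ℝ, 1 / 3 * (x + (y + w)) = (x + y + w) / 3 from fun x y w => by ring]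
    refine le_of_pow_three_eq (by positivity) (by positivity) (by positivity) ?_
    have hc : shiftDensity b' z * (shiftDensity b' z)⁻¹ = 1 := mul_inv_cancel₀ p2.ne'
    linear_combination (-(shiftDensity b z ^ (3 * k + 3) * mixDensity q a (z - b) ^ (3 * k + 3) *
      (shiftDensity b' z)⁻¹ ^ (3 * k) * (mixDensity q a' (z - b'))⁻¹ ^ (3 * k))) * hc
  have m1 : Measurable fun z => ENNReal.ofReal
      (shiftDensity b z * mixDensity q a (z - b) ^ (3 * (k + 1))) :=
    ((continuous_shiftDensity b).measurable.mul (((measurable_mixDensity q a).comp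
      (measurable_id.sub_const b)).pow_const _)).ennreal_ofReal
  have m2 : Measurable fun z => ENNReal.ofReal
      (shiftDensity b' z * (mixDensity q a' (z - b'))⁻¹ ^ (3 * k)) :=
    ((continuous_shiftDensity b').measurable.mul (((measurable_mixDensity q a').comp
      (measurable_id.sub_const b')).inv.pow_const _)).ennreal_ofReal
  calc _ ≤ _ := lintegral_mono hpt
    _ ≤ ENNReal.ofReal (1 / 3) * (ENNReal.ofReal (Real.exp c) +
        (ENNReal.ofReal (Real.exp c) + ENNReal.ofReal (Real.exp c))) := by
        rw [lintegral_const_mul' _ _ ENNReal.ofReal_ne_top, lintegral_add_left m1,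
          lintegral_add_left m2]
        gcongr
    _ = _ := by
        have := Real.exp_pos c
        rw [← ENNReal.ofReal_add (by positivity) (by positivity),
          ← ENNReal.ofReal_add (by positivity) (by positivity), ← ENNReal.ofReal_mul (by norm_num)]
        congr 1
        ring

/-- Joint convexity of the Rényi power: mixtures can be compared component by component. -/
theorem mixture_pow_mul_inv_pow_le {ι ι' : Type*} [Fintype ι] [Fintype ι'] {u f : ι → ℝ}
    {u' f' : ι' → ℝ} (hu : ∀ i, 0 ≤ u i) (hu' : ∀ i, 0 ≤ u' i) (hU : 0 < ∑ i, u i)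
    (hU' : 0 < ∑ i, u' i) (hf : ∀ i, 0 < f i) (hf' : ∀ i, 0 < f' i) (l k : ℕ) :
    (∑ i, u i * f i) ^ l * (∑ i, u' i * f' i)⁻¹ ^ k ≤
      ((∑ i, u i) ^ l * (∑ i, u' i)⁻¹ ^ k) * ∑ i, ∑ j, (u i / ∑ i, u i) * (u' j / ∑ i, u' i) *
        (f i ^ l * (f' j)⁻¹ ^ k) := by
  set U := ∑ i, u i
  set U' := ∑ i, u' i
  have h1 := Real.pow_arith_mean_le_arith_mean_pow Finset.univ (fun i => u i / U) f
    (fun i _ => div_nonneg (hu i) hU.le) (by rw [← Finset.sum_div]; exact div_self hU.ne')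
    (fun i _ => (hf i).le) l
  have h2 := Real.zpow_arith_mean_le_arith_mean_zpow Finset.univ (fun i => u' i / U') f'
    (fun i _ => div_nonneg (hu' i) hU'.le) (by rw [← Finset.sum_div]; exact div_self hU'.ne')
    (fun i _ => hf' i) (-k)
  simp only [zpow_neg, zpow_natCast, ← inv_pow] at h2
  have e1 : ∑ i, u i * f i = U * ∑ i, u i / U * f i := by
    rw [Finset.mul_sum]
    exact Finset.sum_congr rfl fun i _ => by field_simp
  have e2 : ∑ i, u' i * f' i = U' * ∑ i, u' i / U' * f' i := by
    rw [Finset.mul_sum]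
    exact Finset.sum_congr rfl fun i _ => by field_simp
  have e3 : ∑ i, ∑ j, (u i / U) * (u' j / U') * (f i ^ l * (f' j)⁻¹ ^ k) =
      (∑ i, u i / U * f i ^ l) * ∑ j, u' j / U' * (f' j)⁻¹ ^ k := by
    rw [Finset.sum_mul_sum]
    exact Finset.sum_congr rfl fun i _ => Finset.sum_congr rfl fun j _ => by ring
  have n1 : 0 ≤ ∑ i, u i / U * f i ^ l :=
    Finset.sum_nonneg fun i _ => mul_nonneg (div_nonneg (hu i) hU.le) (pow_nonneg (hf i).le _)
  have n2 : 0 ≤ ∑ i, u' i / U' * f' i :=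
    Finset.sum_nonneg fun i _ => mul_nonneg (div_nonneg (hu' i) hU'.le) (hf' i).le
  rw [e1, e2, e3, mul_pow, mul_inv, mul_pow]
  calc _ = U ^ l * U'⁻¹ ^ k * ((∑ i, u i / U * f i) ^ l * (∑ i, u' i / U' * f' i)⁻¹ ^ k) := by
        ring
    _ ≤ _ := by gcongr

theorem lintegral_mixture_pow_mul_inv_pow_le {ι ι' Ω : Type*} [Fintype ι] [Fintype ι']
    [MeasurableSpace Ω] {μ : Measure Ω} {u : ι → ℝ} {u' : ι' → ℝ} {f : ι → Ω → ℝ} {f' : ι' → Ω → ℝ}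
    (hu : ∀ i, 0 ≤ u i) (hu' : ∀ i, 0 ≤ u' i) (hU : 0 < ∑ i, u i) (hU' : 0 < ∑ i, u' i)
    (hf : ∀ i z, 0 < f i z) (hf' : ∀ i z, 0 < f' i z) (hm : ∀ i, Measurable (f i))
    (hm' : ∀ i, Measurable (f' i)) {l k : ℕ} {c : ENNReal}
    (h : ∀ i j, ∫⁻ z, ENNReal.ofReal (f i z ^ l * (f' j z)⁻¹ ^ k) ∂μ ≤ c) :
    ∫⁻ z, ENNReal.ofReal ((∑ i, u i * f i z) ^ l * (∑ i, u' i * f' i z)⁻¹ ^ k) ∂μ ≤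
      ENNReal.ofReal ((∑ i, u i) ^ l * (∑ i, u' i)⁻¹ ^ k) * c := by
  have hmix := fun z => mixture_pow_mul_inv_pow_le hu hu' hU hU' (fun i => hf i z)
    (fun i => hf' i z) l k
  set U := ∑ i, u i with hUdef
  set U' := ∑ i, u' i with hUdef'
  have hw : ∀ i j, 0 ≤ u i / U * (u' j / U') := fun i j =>
    mul_nonneg (div_nonneg (hu i) hU.le) (div_nonneg (hu' j) hU'.le)
  have hp : ∀ i j z, 0 ≤ f i z ^ l * (f' j z)⁻¹ ^ k := fun i j z => by
    have := hf i z
    have := hf' j z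
    positivity
  have hmm : ∀ i j, Measurable fun z => ENNReal.ofReal (u i / U * (u' j / U')) *
      ENNReal.ofReal (f i z ^ l * (f' j z)⁻¹ ^ k) := fun i j =>
    (((hm i).pow_const l).mul ((hm' j).inv.pow_const k)).ennreal_ofReal.const_mul _
  have hsum : ∑ i, ∑ j, ENNReal.ofReal (u i / U * (u' j / U')) = 1 := by
    calc _ = ∑ i, ENNReal.ofReal (∑ j, u i / U * (u' j / U')) :=
          Finset.sum_congr rfl fun i _ => (ENNReal.ofReal_sum_of_nonneg fun j _ => hw i j).symm
      _ = ENNReal.ofReal (∑ i, ∑ j, u i / U * (u' j / U')) :=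
          (ENNReal.ofReal_sum_of_nonneg fun i _ => Finset.sum_nonneg fun j _ => hw i j).symm
      _ = 1 := by
          rw [← Finset.sum_mul_sum, ← Finset.sum_div, ← Finset.sum_div, ← hUdef, ← hUdef',
            div_self hU.ne', div_self hU'.ne', mul_one, ENNReal.ofReal_one]
  calc _ ≤ ∫⁻ z, ENNReal.ofReal (U ^ l * U'⁻¹ ^ k) * ∑ i, ∑ j,
        ENNReal.ofReal (u i / U * (u' j / U')) *
          ENNReal.ofReal (f i z ^ l * (f' j z)⁻¹ ^ k) ∂μ := by
        refine lintegral_mono fun z => (ENNReal.ofReal_le_ofReal (hmix z)).trans_eq ?_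
        rw [ENNReal.ofReal_mul (by positivity), ENNReal.ofReal_sum_of_nonneg
          fun i _ => Finset.sum_nonneg fun j _ => mul_nonneg (hw i j) (hp i j z)]
        congr 1
        refine Finset.sum_congr rfl fun i _ => ?_
        rw [ENNReal.ofReal_sum_of_nonneg fun j _ => mul_nonneg (hw i j) (hp i j z)]
        exact Finset.sum_congr rfl fun j _ => ENNReal.ofReal_mul (hw i j)
    _ = ENNReal.ofReal (U ^ l * U'⁻¹ ^ k) * ∑ i, ∑ j, ENNReal.ofReal (u i / U * (u' j / U')) *
          ∫⁻ z, ENNReal.ofReal (f i z ^ l * (f' j z)⁻¹ ^ k) ∂μ := by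
        rw [lintegral_const_mul' _ _ ENNReal.ofReal_ne_top,
          lintegral_finsetSum _ fun i _ => Finset.measurable_sum _ fun j _ => hmm i j]
        congr 1
        refine Finset.sum_congr rfl fun i _ => ?_
        rw [lintegral_finsetSum _ fun j _ => hmm i j]
        exact Finset.sum_congr rfl fun j _ => lintegral_const_mul' _ _ ENNReal.ofReal_ne_top
    _ ≤ ENNReal.ofReal (U ^ l * U'⁻¹ ^ k) *
          ∑ i, ∑ j, ENNReal.ofReal (u i / U * (u' j / U')) * c := by
        gcongr with i _ j _
        exact h i j
    _ = _ := by
        simp only [← Finset.sum_mul]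
        rw [hsum, one_mul]

end SoteriaFL

/-! ### Composition over the rounds -/

namespace SoteriaFL

variable {d : ℕ} {X : Type*}

/-- What the differing sample adds to the noise in one round, if `a` is its term in the minibatch
sum, `b` its term in the full gradient, and `β` tells whether it is in the minibatch. -/
noncomputable def contribution (a b : Vec d) (β : Bool) : Vec d := if β then a + b else b

theorem measurable_contribution {Y : Type*} [MeasurableSpace Y] {f g : Y → Vec d} {h : Y → Bool}
    (hf : Measurable f) (hg : Measurable g) (hh : Measurable h) :
    Measurable fun y => contribution (f y) (g y) (h y) :=
  Measurable.ite (hh (measurableSet_singleton true)) (hf.add hg) hg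

/-- The joint density of the rounds `s < t` together with the minibatch indicators `β` of the
differing sample, with respect to the law of the rounds in a run without this sample.  The terms
`A`, `B` of the sample may depend on the past and on its own past indicators. -/
noncomputable def jointDensity (q : ℝ) (N : X → Vec d)
    (A B : (t : ℕ) → (Fin t → X) → (Fin t → Bool) → Vec d) :
    (t : ℕ) → (Fin t → X) → (Fin t → Bool) → ℝ
  | 0, _, _ => 1
  | t + 1, x, β =>
    jointDensity q N A B t (Fin.init x) (Fin.init β) *
      ((if β (Fin.last t) then q else 1 - q) *
        shiftDensity (contribution (A t (Fin.init x) (Fin.init β)) (B t (Fin.init x) (Fin.init β))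
          (β (Fin.last t))) (N (x (Fin.last t))))

/-- The density of the rounds `s < t` alone: the hidden minibatch indicators are summed out. -/
noncomputable def transcriptDensity (q : ℝ) (N : X → Vec d)
    (A B : (t : ℕ) → (Fin t → X) → (Fin t → Bool) → Vec d) (t : ℕ) (x : Fin t → X) : ℝ :=
  ∑ β, jointDensity q N A B t x β

section Density

variable {q : ℝ} {N : X → Vec d} {A B : (t : ℕ) → (Fin t → X) → (Fin t → Bool) → Vec d}

theorem jointDensity_nonneg (hq0 : 0 ≤ q) (hq1 : q ≤ 1) (t : ℕ) (x : Fin t → X)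
    (β : Fin t → Bool) : 0 ≤ jointDensity q N A B t x β := by
  induction t with
  | zero => exact zero_le_one
  | succ t ih =>
    refine mul_nonneg (ih _ _) (mul_nonneg ?_ (shiftDensity_pos _ _).le)
    split_ifs <;> linarith

theorem sum_snoc_bool {M : Type*} [AddCommMonoid M] {t : ℕ} (f : (Fin (t + 1) → Bool) → M) :
    ∑ β, f β = ∑ β : Fin t → Bool, ∑ b : Bool, f (Fin.snoc (α := fun _ => Bool) β b) := by
  rw [← (Fin.snocEquiv (fun _ => Bool)).sum_comp, Fintype.sum_prod_type_right]
  rfl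

theorem jointDensity_snoc (t : ℕ) (x : Fin t → X) (c : X) (β : Fin t → Bool) (b : Bool) :
    jointDensity q N A B (t + 1) (Fin.snoc (α := fun _ => X) x c)
        (Fin.snoc (α := fun _ => Bool) β b) =
      jointDensity q N A B t x β * ((if b then q else 1 - q) *
        shiftDensity (contribution (A t x β) (B t x β) b) (N c)) := by
  simp [jointDensity]

theorem transcriptDensity_snoc (t : ℕ) (x : Fin t → X) (c : X) :
    transcriptDensity q N A B (t + 1) (Fin.snoc (α := fun _ => X) x c) =
      ∑ β, jointDensity q N A B t x β * roundDensity q (A t x β) (B t x β) (N c) := by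
  rw [transcriptDensity, sum_snoc_bool]
  refine Finset.sum_congr rfl fun β _ => ?_
  simp only [jointDensity_snoc, Fintype.sum_bool, contribution, roundDensity]
  simp
  ring

theorem transcriptDensity_pos (hq0 : 0 ≤ q) (hq1 : q ≤ 1) (t : ℕ) (x : Fin t → X) :
    0 < transcriptDensity q N A B t x := by
  induction t with
  | zero => simp [transcriptDensity, jointDensity]
  | succ t ih =>
    rw [← Fin.snoc_init_self x, transcriptDensity_snoc]
    have h := ih (Fin.init x)
    obtain ⟨β, -, hβ⟩ := Finset.exists_ne_zero_of_sum_ne_zero h.ne'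
    refine Finset.sum_pos' (fun β _ => mul_nonneg (jointDensity_nonneg hq0 hq1 _ _ _)
      (roundDensity_pos hq0 hq1 _ _ _).le) ⟨β, Finset.mem_univ _, ?_⟩
    exact mul_pos ((jointDensity_nonneg hq0 hq1 _ _ _).lt_of_ne' hβ) (roundDensity_pos hq0 hq1 _ _ _)

variable [MeasurableSpace X]

theorem measurable_init {t : ℕ} : Measurable (fun x : Fin (t + 1) → X => (Fin.init x : Fin t → X)) :=
  measurable_pi_lambda _ fun s => measurable_pi_apply s.castSucc

theorem measurable_jointDensity (hN : Measurable N) (hA : ∀ t β, Measurable fun x => A t x β)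
    (hB : ∀ t β, Measurable fun x => B t x β) (t : ℕ) (β : Fin t → Bool) :
    Measurable fun x => jointDensity q N A B t x β := by
  induction t with
  | zero => exact measurable_const
  | succ t ih =>
    have h1 := (hA t (Fin.init β)).comp (measurable_init (X := X))
    have h2 := (hB t (Fin.init β)).comp (measurable_init (X := X))
    exact ((ih _).comp measurable_init).mul (Measurable.const_mul (measurable_shiftDensity
      (measurable_contribution h1 h2 measurable_const) (hN.comp (measurable_pi_apply _))) _)

theorem measurable_transcriptDensity (hN : Measurable N)
    (hA : ∀ t β, Measurable fun x => A t x β) (hB : ∀ t β, Measurable fun x => B t x β) (t : ℕ) :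
    Measurable (transcriptDensity q N A B t) :=
  Finset.measurable_sum _ fun β _ => measurable_jointDensity hN hA hB t β

end Density

variable [MeasurableSpace X]

theorem measurable_snoc {t : ℕ} :
    Measurable fun p : (Fin t → X) × X => (Fin.snoc (α := fun _ => X) p.1 p.2 : Fin (t + 1) → X) := by
  refine measurable_pi_lambda _ fun s => ?_
  induction s using Fin.lastCases with
  | last => simpa using measurable_snd
  | cast s =>
    simp only [Fin.snoc_castSucc]
    exact (measurable_pi_apply s).comp measurable_fst

/-- Fubini for the last of `t + 1` independent rounds. -/
theorem lintegral_pi_snoc (ν : ℕ → Measure X) [∀ t, IsProbabilityMeasure (ν t)] (t : ℕ)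
    {f : (Fin (t + 1) → X) → ENNReal} (hf : Measurable f) :
    ∫⁻ x, f x ∂(Measure.pi fun s : Fin (t + 1) => ν s) =
      ∫⁻ x, ∫⁻ c, f (Fin.snoc (α := fun _ => X) x c) ∂(ν t) ∂(Measure.pi fun s : Fin t => ν s) := by
  have h := (measurePreserving_piFinSuccAbove (fun s : Fin (t + 1) => ν s) (Fin.last t)).symm
  rw [← h.lintegral_comp hf]
  simp only [Fin.succAbove_last, Fin.val_castSucc, Fin.val_last]
  have hf' : Measurable fun p : X × (Fin t → X) => f (Fin.snoc (α := fun _ => X) p.2 p.1) :=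
    hf.comp (measurable_snoc.comp measurable_swap)
  have e : ∀ p : X × (Fin t → X), f ((MeasurableEquiv.piFinSuccAbove (fun _ => X)
      (Fin.last t)).symm p) = f (Fin.snoc (α := fun _ => X) p.2 p.1) := fun p => by
    congr 1
    simp [MeasurableEquiv.piFinSuccAbove_symm_apply, Fin.insertNthEquiv, Fin.insertNth_last']
  simp only [e]
  rw [lintegral_prod_symm' _ hf']

section Renyi

variable {q a b : ℝ} {N : X → Vec d} {A B A' B' : (t : ℕ) → (Fin t → X) → (Fin t → Bool) → Vec d}
  {ν : ℕ → Measure X} [∀ t, IsProbabilityMeasure (ν t)]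

/-- The Rényi power of two transcripts grows by at most a constant factor in each round.  Given the
past transcript, a round is a mixture over the hidden past indicators, and joint convexity reduces
it to rounds with fixed contributions. -/
theorem lintegral_transcriptDensity_le (hq0 : 0 ≤ q) (hq1 : q ≤ 1) {k : ℕ} (hk : 1 ≤ k)
    (ha : 18 * ((k : ℝ) + 1) * a ^ 2 ≤ 1) (hN : Measurable N)
    (hν : ∀ t, (ν t).map N = stdGaussian (Vec d))
    (hmA : ∀ t β, Measurable fun x => A t x β) (hmB : ∀ t β, Measurable fun x => B t x β)
    (hmA' : ∀ t β, Measurable fun x => A' t x β) (hmB' : ∀ t β, Measurable fun x => B' t x β)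
    (hA : ∀ t x β, ‖A t x β‖ ≤ a) (hB : ∀ t x β, ‖B t x β‖ ≤ b)
    (hA' : ∀ t x β, ‖A' t x β‖ ≤ a) (hB' : ∀ t x β, ‖B' t x β‖ ≤ b) (t : ℕ) :
    ∫⁻ x, ENNReal.ofReal (transcriptDensity q N A B t x ^ (k + 1) *
        (transcriptDensity q N A' B' t x)⁻¹ ^ k) ∂(Measure.pi fun s : Fin t => ν s) ≤
      ENNReal.ofReal (Real.exp (t * roundCost q a b k)) := by
  have hm : ∀ t, Measurable fun x => transcriptDensity q N A B t x ^ (k + 1) *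
        (transcriptDensity q N A' B' t x)⁻¹ ^ k := fun t =>
    ((measurable_transcriptDensity hN hmA hmB t).pow_const _).mul
      ((measurable_transcriptDensity hN hmA' hmB' t).inv.pow_const _)
  induction t with
  | zero => simp [transcriptDensity, jointDensity]
  | succ t ih =>
    rw [lintegral_pi_snoc ν t (hm (t + 1)).ennreal_ofReal]
    have hstep : ∀ x : Fin t → X, ∫⁻ c, ENNReal.ofReal
        (transcriptDensity q N A B (t + 1) (Fin.snoc (α := fun _ => X) x c) ^ (k + 1) *
          (transcriptDensity q N A' B' (t + 1) (Fin.snoc (α := fun _ => X) x c))⁻¹ ^ k) ∂(ν t) ≤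
        ENNReal.ofReal (transcriptDensity q N A B t x ^ (k + 1) *
          (transcriptDensity q N A' B' t x)⁻¹ ^ k) *
            ENNReal.ofReal (Real.exp (roundCost q a b k)) := by
      intro x
      have hP := transcriptDensity_pos (N := N) (A := A) (B := B) hq0 hq1 t x
      have hP' := transcriptDensity_pos (N := N) (A := A') (B := B') hq0 hq1 t x
      simp only [transcriptDensity_snoc]
      refine lintegral_mixture_pow_mul_inv_pow_le (jointDensity_nonneg hq0 hq1 t x)
        (jointDensity_nonneg hq0 hq1 t x) hP hP' (fun β c => roundDensity_pos hq0 hq1 _ _ _)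
        (fun β c => roundDensity_pos hq0 hq1 _ _ _)
        (fun β => (measurable_roundDensity _ _ _).comp hN)
        (fun β => (measurable_roundDensity _ _ _).comp hN) fun β β' => ?_
      have hr : Measurable fun z : Vec d => ENNReal.ofReal
          (roundDensity q (A t x β) (B t x β) z ^ (k + 1) *
            (roundDensity q (A' t x β') (B' t x β') z)⁻¹ ^ k) :=
        (((measurable_roundDensity _ _ _).pow_const _).mul
          ((measurable_roundDensity _ _ _).inv.pow_const _)).ennreal_ofReal
      rw [← lintegral_map hr hN, hν]
      exact lintegral_roundDensity_le hq0 hq1 hk ha (hA _ _ _) (hB _ _ _) (hA' _ _ _) (hB' _ _ _)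
    calc _ ≤ _ := lintegral_mono hstep
      _ ≤ ENNReal.ofReal (Real.exp (t * roundCost q a b k)) *
          ENNReal.ofReal (Real.exp (roundCost q a b k)) := by
          rw [lintegral_mul_const' _ _ ENNReal.ofReal_ne_top]
          gcongr
      _ = _ := by
          rw [← ENNReal.ofReal_mul (Real.exp_pos _).le, ← Real.exp_add]
          congr 2
          push_cast
          ring

/-- From Rényi powers to approximate differential privacy. -/
theorem le_exp_mul_add_of_pow {p p' ε : ℝ} (hp : 0 < p) (hp' : 0 < p') (k : ℕ) :
    p ≤ Real.exp ε * p' + Real.exp (-(k * ε)) * (p ^ (k + 1) * p'⁻¹ ^ k) := by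
  rcases le_or_gt p (Real.exp ε * p') with h | h
  · have : 0 ≤ Real.exp (-(k * ε)) * (p ^ (k + 1) * p'⁻¹ ^ k) := by positivity
    linarith
  · have h1 : Real.exp ε ≤ p * p'⁻¹ := by
      rw [← div_eq_mul_inv, le_div_iff₀ hp']
      exact h.le
    have h2 : Real.exp (k * ε) ≤ (p * p'⁻¹) ^ k := by
      rw [Real.exp_nat_mul]
      gcongr
    have h3 : 0 < Real.exp ε * p' := by positivity
    calc p = Real.exp (-(k * ε)) * (p * Real.exp (k * ε)) := by
          rw [mul_left_comm, ← Real.exp_add]; simp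
      _ ≤ Real.exp (-(k * ε)) * (p * (p * p'⁻¹) ^ k) := by gcongr
      _ = Real.exp (-(k * ε)) * (p ^ (k + 1) * p'⁻¹ ^ k) := by rw [mul_pow]; ring
      _ ≤ _ := by linarith

theorem lintegral_transcriptDensity_le_exp_mul_add (hq0 : 0 ≤ q) (hq1 : q ≤ 1) {k : ℕ}
    (hk : 1 ≤ k) (ha : 18 * ((k : ℝ) + 1) * a ^ 2 ≤ 1) (hN : Measurable N)
    (hν : ∀ t, (ν t).map N = stdGaussian (Vec d))
    (hmA : ∀ t β, Measurable fun x => A t x β) (hmB : ∀ t β, Measurable fun x => B t x β)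
    (hmA' : ∀ t β, Measurable fun x => A' t x β) (hmB' : ∀ t β, Measurable fun x => B' t x β)
    (hA : ∀ t x β, ‖A t x β‖ ≤ a) (hB : ∀ t x β, ‖B t x β‖ ≤ b)
    (hA' : ∀ t x β, ‖A' t x β‖ ≤ a) (hB' : ∀ t x β, ‖B' t x β‖ ≤ b) (t : ℕ) (ε : ℝ)
    {f : (Fin t → X) → ENNReal} (hf : Measurable f) (hf1 : ∀ x, f x ≤ 1) :
    ∫⁻ x, ENNReal.ofReal (transcriptDensity q N A B t x) * f x ∂(Measure.pi fun s : Fin t => ν s) ≤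
      ENNReal.ofReal (Real.exp ε) * ∫⁻ x, ENNReal.ofReal (transcriptDensity q N A' B' t x) * f x
        ∂(Measure.pi fun s : Fin t => ν s) +
      ENNReal.ofReal (Real.exp (-(k * ε) + t * roundCost q a b k)) := by
  have hm' := measurable_transcriptDensity (q := q) hN hmA' hmB' t
  calc _ ≤ ∫⁻ x, ENNReal.ofReal (Real.exp ε) *
        (ENNReal.ofReal (transcriptDensity q N A' B' t x) * f x) +
        ENNReal.ofReal (Real.exp (-(k * ε))) *
          ENNReal.ofReal (transcriptDensity q N A B t x ^ (k + 1) *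
            (transcriptDensity q N A' B' t x)⁻¹ ^ k) ∂(Measure.pi fun s : Fin t => ν s) := by
        refine lintegral_mono fun x => ?_
        have hP := transcriptDensity_pos (N := N) (A := A) (B := B) hq0 hq1 t x
        have hP' := transcriptDensity_pos (N := N) (A := A') (B := B') hq0 hq1 t x
        have h := ENNReal.ofReal_le_ofReal (le_exp_mul_add_of_pow (ε := ε) hP hP' k)
        rw [ENNReal.ofReal_add (by positivity) (by positivity),
          ENNReal.ofReal_mul (Real.exp_pos _).le, ENNReal.ofReal_mul (Real.exp_pos _).le] at h
        calc _ ≤ _ := mul_le_mul_left h (f x)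
          _ ≤ _ := by
            rw [add_mul, mul_assoc]
            exact add_le_add le_rfl (mul_le_of_le_one_right' (hf1 x))
    _ ≤ _ := by
        have hm2 : Measurable fun x => ENNReal.ofReal (Real.exp ε) *
            (ENNReal.ofReal (transcriptDensity q N A' B' t x) * f x) :=
          (hm'.ennreal_ofReal.mul hf).const_mul _
        rw [lintegral_add_left hm2,
          lintegral_const_mul' _ _ ENNReal.ofReal_ne_top,
          lintegral_const_mul' _ _ ENNReal.ofReal_ne_top, Real.exp_add,
          ENNReal.ofReal_mul (Real.exp_pos _).le]
        gcongr
        exact lintegral_transcriptDensity_le hq0 hq1 hk ha hN hν hmA hmB hmA' hmB' hA hB hA' hB' t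

end Renyi

end SoteriaFL

/-! ### The law of the transcript -/

namespace SoteriaFL

variable {d : ℕ} {X : Type*}

/-- The coins with which a run without the differing sample produces the messages of the run with
it: in each round, `move a` shifts the noise by the contribution `a` of the sample (and erases its
minibatch indicator, which `bit` reads off). -/
noncomputable def replay (move : Vec d → X → X) (bit : X → Bool)
    (A B : (t : ℕ) → (Fin t → X) → (Fin t → Bool) → Vec d) : (t : ℕ) → (Fin t → X) → (Fin t → X)
  | 0, _ => Fin.elim0
  | t + 1, ω =>
    let x := replay move bit A B t (Fin.init ω)
    let β : Fin t → Bool := fun s => bit (Fin.init (α := fun _ => X) ω s)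
    Fin.snoc (α := fun _ => X) x
      (move (contribution (A t x β) (B t x β) (bit (ω (Fin.last t)))) (ω (Fin.last t)))

section

variable {move : Vec d → X → X} {bit : X → Bool}
    {A B : (t : ℕ) → (Fin t → X) → (Fin t → Bool) → Vec d}

theorem replay_succ_init (t : ℕ) (ω : Fin (t + 1) → X) :
    (Fin.init (replay move bit A B (t + 1) ω) : Fin t → X) =
      replay move bit A B t (Fin.init ω) := by
  simp [replay]

theorem replay_snoc (t : ℕ) (ω : Fin t → X) (c : X) :
    replay move bit A B (t + 1) (Fin.snoc (α := fun _ => X) ω c) =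
      Fin.snoc (α := fun _ => X) (replay move bit A B t ω)
        (move (contribution (A t (replay move bit A B t ω) fun s => bit (ω s))
          (B t (replay move bit A B t ω) fun s => bit (ω s)) (bit c)) c) := by
  simp [replay]

variable [MeasurableSpace X]

theorem measurable_of_measurable_section {Y ι Z : Type*} [MeasurableSpace Y] [MeasurableSpace Z]
    [MeasurableSpace ι] [Countable ι] [MeasurableSingletonClass ι] {W : Type*} [MeasurableSpace W]
    {f : Y → ι → Z} (hf : ∀ i, Measurable fun y => f y i) {g : W → Y} {h : W → ι}
    (hg : Measurable g) (hh : Measurable h) : Measurable fun w => f (g w) (h w) :=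
  (measurable_from_prod_countable_left (f := fun p : Y × ι => f p.1 p.2) hf).comp (hg.prodMk hh)

theorem measurable_replay (hmove : Measurable fun p : Vec d × X => move p.1 p.2)
    (hbit : Measurable bit) (hmA : ∀ t β, Measurable fun x => A t x β)
    (hmB : ∀ t β, Measurable fun x => B t x β) (t : ℕ) :
    Measurable (replay move bit A B t) := by
  induction t with
  | zero => exact measurable_const
  | succ t ih =>
    have h1 := ih.comp (measurable_init (X := X))
    have hβ : Measurable fun ω : Fin (t + 1) → X =>
        (fun s => bit (Fin.init (α := fun _ => X) ω s) : Fin t → Bool) :=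
      measurable_pi_lambda _ fun s => hbit.comp (measurable_pi_apply s.castSucc)
    have hlast : Measurable fun ω : Fin (t + 1) → X => ω (Fin.last t) := measurable_pi_apply _
    have hA := measurable_of_measurable_section (hmA t) h1 hβ
    have hB := measurable_of_measurable_section (hmB t) h1 hβ
    exact measurable_snoc.comp (h1.prodMk (hmove.comp
      ((measurable_contribution hA hB (hbit.comp hlast)).prodMk hlast)))

/-- The law of the replayed coins, jointly with the minibatch indicators of the differing sample,
has the density `jointDensity`, if this is so in each single round. -/
theorem lintegral_replay {q : ℝ} (hq0 : 0 ≤ q) (hq1 : q ≤ 1) {N : X → Vec d} {μ ν : ℕ → Measure X}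
    [∀ t, IsProbabilityMeasure (μ t)] [∀ t, IsProbabilityMeasure (ν t)]
    (hN : Measurable N) (hmove : Measurable fun p : Vec d × X => move p.1 p.2)
    (hbit : Measurable bit) (hmA : ∀ t β, Measurable fun x => A t x β)
    (hmB : ∀ t β, Measurable fun x => B t x β)
    (hround : ∀ (t : ℕ) (g : X → Bool → ENNReal), (∀ b, Measurable fun c => g c b) →
      ∀ a : Bool → Vec d, ∫⁻ c, g (move (a (bit c)) c) (bit c) ∂(μ t) =
        ∑ b, ∫⁻ c, ENNReal.ofReal ((if b then q else 1 - q) * shiftDensity (a b) (N c)) * g c b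
          ∂(ν t))
    (t : ℕ) (f : (Fin t → X) → (Fin t → Bool) → ENNReal) (hf : ∀ β, Measurable fun x => f x β) :
    ∫⁻ ω, f (replay move bit A B t ω) (fun s => bit (ω s)) ∂(Measure.pi fun s : Fin t => μ s) =
      ∑ β, ∫⁻ x, ENNReal.ofReal (jointDensity q N A B t x β) * f x β
        ∂(Measure.pi fun s : Fin t => ν s) := by
  induction t with
  | zero =>
    have h : ∀ x β, f x β = f Fin.elim0 Fin.elim0 := fun x β => by
      rw [Subsingleton.elim x Fin.elim0, Subsingleton.elim β Fin.elim0]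
    rw [Fintype.sum_unique]
    simp only [jointDensity, h]
    simp
  | succ t ih =>
    have hm : Measurable fun ω : Fin (t + 1) → X =>
        f (replay move bit A B (t + 1) ω) (fun s => bit (ω s)) :=
      measurable_of_measurable_section hf (measurable_replay hmove hbit hmA hmB (t + 1))
        (measurable_pi_lambda _ fun s => hbit.comp (measurable_pi_apply s))
    have hbits : ∀ (ω : Fin t → X) (c : X), (fun s => bit (Fin.snoc (α := fun _ => X) ω c s)) =
        Fin.snoc (α := fun _ => Bool) (fun s => bit (ω s)) (bit c) := by
      intro ω c
      funext s
      induction s using Fin.lastCases <;> simp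
    rw [lintegral_pi_snoc μ t hm]
    simp only [hbits, replay_snoc]
    have hg : ∀ β b, Measurable fun p : (Fin t → X) × X =>
        f (Fin.snoc (α := fun _ => X) p.1 p.2) (Fin.snoc (α := fun _ => Bool) β b) :=
      fun β b => (hf _).comp measurable_snoc
    have hc : ∀ β b, Measurable fun x => contribution (A t x β) (B t x β) b :=
      fun β b => measurable_contribution (hmA t β) (hmB t β) measurable_const
    have hinner : ∀ β b, Measurable fun p : (Fin t → X) × X =>
        ENNReal.ofReal ((if b then q else 1 - q) *
          shiftDensity (contribution (A t p.1 β) (B t p.1 β) b) (N p.2)) *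
        f (Fin.snoc (α := fun _ => X) p.1 p.2) (Fin.snoc (α := fun _ => Bool) β b) :=
      fun β b => ((measurable_shiftDensity ((hc β b).comp measurable_fst)
        (hN.comp measurable_snd)).const_mul _).ennreal_ofReal.mul (hg β b)
    have hstep := fun (x : Fin t → X) (β : Fin t → Bool) => hround t
      (fun c b => f (Fin.snoc (α := fun _ => X) x c) (Fin.snoc (α := fun _ => Bool) β b))
      (fun b => (hg β b).comp measurable_prodMk_left)
      (contribution (A t x β) (B t x β))
    simp only [hstep]
    rw [ih (fun x β => ∑ b, ∫⁻ c, ENNReal.ofReal ((if b then q else 1 - q) *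
        shiftDensity (contribution (A t x β) (B t x β) b) (N c)) *
        f (Fin.snoc (α := fun _ => X) x c) (Fin.snoc (α := fun _ => Bool) β b) ∂(ν t))
      (fun β => Finset.measurable_sum _ fun b _ => (hinner β b).lintegral_prod_right'),
      sum_snoc_bool]
    refine Finset.sum_congr rfl fun β _ => ?_
    simp only [Finset.mul_sum]
    have hJ := measurable_jointDensity (q := q) hN hmA hmB
    have hprod : ∀ b, Measurable fun x => ENNReal.ofReal (jointDensity q N A B t x β) *
        ∫⁻ c, ENNReal.ofReal ((if b then q else 1 - q) *
          shiftDensity (contribution (A t x β) (B t x β) b) (N c)) *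
          f (Fin.snoc (α := fun _ => X) x c) (Fin.snoc (α := fun _ => Bool) β b) ∂(ν t) :=
      fun b => (hJ t β).ennreal_ofReal.mul (hinner β b).lintegral_prod_right'
    rw [lintegral_finsetSum _ fun b _ => hprod b]
    refine Finset.sum_congr rfl fun b _ => ?_
    have hJf : ∀ β, Measurable fun x => ENNReal.ofReal (jointDensity q N A B (t + 1) x β) * f x β :=
      fun β => (hJ (t + 1) β).ennreal_ofReal.mul (hf β)
    rw [lintegral_pi_snoc ν t (hJf _)]
    refine lintegral_congr fun x => ?_
    rw [← lintegral_const_mul' _ _ ENNReal.ofReal_ne_top]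
    refine lintegral_congr fun c => ?_
    rw [jointDensity_snoc, ENNReal.ofReal_mul (jointDensity_nonneg hq0 hq1 t x β), mul_assoc]

theorem lintegral_replay_eq_transcriptDensity {q : ℝ} (hq0 : 0 ≤ q) (hq1 : q ≤ 1) {N : X → Vec d}
    {μ ν : ℕ → Measure X}
    [∀ t, IsProbabilityMeasure (μ t)] [∀ t, IsProbabilityMeasure (ν t)]
    (hN : Measurable N) (hmove : Measurable fun p : Vec d × X => move p.1 p.2)
    (hbit : Measurable bit) (hmA : ∀ t β, Measurable fun x => A t x β)
    (hmB : ∀ t β, Measurable fun x => B t x β)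
    (hround : ∀ (t : ℕ) (g : X → Bool → ENNReal), (∀ b, Measurable fun c => g c b) →
      ∀ a : Bool → Vec d, ∫⁻ c, g (move (a (bit c)) c) (bit c) ∂(μ t) =
        ∑ b, ∫⁻ c, ENNReal.ofReal ((if b then q else 1 - q) * shiftDensity (a b) (N c)) * g c b
          ∂(ν t))
    (t : ℕ) {f : (Fin t → X) → ENNReal} (hf : Measurable f) :
    ∫⁻ ω, f (replay move bit A B t ω) ∂(Measure.pi fun s : Fin t => μ s) =
      ∫⁻ x, ENNReal.ofReal (transcriptDensity q N A B t x) * f x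
        ∂(Measure.pi fun s : Fin t => ν s) := by
  have hm : ∀ β, Measurable fun x => ENNReal.ofReal (jointDensity q N A B t x β) * f x :=
    fun β => (measurable_jointDensity hN hmA hmB t β).ennreal_ofReal.mul hf
  rw [lintegral_replay hq0 hq1 hN hmove hbit hmA hmB hround t (fun x _ => f x) fun _ => hf,
    ← lintegral_finsetSum _ fun β _ => hm β]
  refine lintegral_congr fun x => ?_
  rw [transcriptDensity, ENNReal.ofReal_sum_of_nonneg fun β _ => jointDensity_nonneg hq0 hq1 t x β,
    Finset.sum_mul]

end

end SoteriaFL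

/-! ### The coins of one round -/

namespace SoteriaFL

variable {n m d b : ℕ} {𝒳 R U : Type*} [MeasurableSpace R] [MeasurableSpace U]

theorem measurable_update_prod {ι : Type*} [DecidableEq ι] {Y : ι → Type*}
    [∀ k, MeasurableSpace (Y k)] (i : ι) :
    Measurable fun p : (∀ k, Y k) × Y i => Function.update p.1 i p.2 := by
  refine measurable_pi_lambda _ fun k => ?_
  by_cases hk : k = i
  · subst hk
    simpa using measurable_snd
  · simp only [Function.update_of_ne hk]
    exact (measurable_pi_apply k).comp measurable_fst

/-- Resampling one of several independent coordinates does not change their law. -/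
theorem lintegral_pi_update {ι : Type*} [Fintype ι] [DecidableEq ι] {Y : ι → Type*}
    [∀ k, MeasurableSpace (Y k)] (μ : ∀ k, Measure (Y k)) [∀ k, IsProbabilityMeasure (μ k)]
    (i : ι) {f : (∀ k, Y k) → ENNReal} (hf : Measurable f) :
    ∫⁻ x, f x ∂(Measure.pi μ) =
      ∫⁻ x, ∫⁻ y, f (Function.update x i y) ∂(μ i) ∂(Measure.pi μ) := by
  have hu := measurable_update_prod (Y := Y) i
  have h : Measure.pi μ =
      ((Measure.pi μ).prod (μ i)).map fun p => Function.update p.1 i p.2 := by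
    refine Measure.pi_eq fun s hs => ?_
    rw [Measure.map_apply hu (MeasurableSet.univ_pi hs)]
    have : (fun p : (∀ k, Y k) × Y i => Function.update p.1 i p.2) ⁻¹' (Set.univ.pi s) =
        (Set.univ.pi (Function.update s i Set.univ)) ×ˢ s i := by
      ext p
      simp only [Set.mem_preimage, Set.mem_pi, Set.mem_univ, true_imp_iff, Set.mem_prod]
      constructor
      · intro hp
        refine ⟨fun k => ?_, by simpa using hp i⟩
        by_cases hk : k = i
        · subst hk
          simp
        · simpa [hk] using hp k
      · rintro ⟨hp, hi⟩ k
        by_cases hk : k = i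
        · subst hk
          simpa using hi
        · simpa [hk] using hp k
    rw [this, Measure.prod_prod, Measure.pi_pi, ← Finset.mul_prod_erase _ _ (Finset.mem_univ i),
      ← Finset.mul_prod_erase Finset.univ (fun k => μ k (s k)) (Finset.mem_univ i)]
    simp only [Function.update_self, measure_univ, one_mul]
    rw [mul_comm]
    congr 1
    refine Finset.prod_congr rfl fun k hk => ?_
    rw [Function.update_of_ne (Finset.ne_of_mem_erase hk)]
  conv_lhs => rw [h]
  rw [lintegral_map hf hu]
  exact lintegral_prod _ (hf.comp hu).aemeasurable

theorem lintegral_bernoulliMeasure_bool (p : unitInterval) (f : Bool → ENNReal) :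
    ∫⁻ β, f β ∂(bernoulliMeasure true false p) =
      ∑ β, ENNReal.ofReal (if β then (p : ℝ) else 1 - p) * f β := by
  have hf : Measurable f := measurable_of_finite f
  rw [bernoulliMeasure_def, lintegral_add_measure, Fintype.sum_bool]
  congr 1
  · rw [lintegral_smul_measure, lintegral_dirac' _ hf, ENNReal.smul_def, smul_eq_mul]
    congr 1
    exact (ENNReal.ofReal_eq_coe_nnreal p.2.1).symm
  · rw [lintegral_smul_measure, lintegral_dirac' _ hf, ENNReal.smul_def, smul_eq_mul]
    congr 1
    exact (ENNReal.ofReal_eq_coe_nnreal (unitInterval.symm p).2.1).symm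

theorem map_smul_gaussianNoise {σ : ℝ} (hσ : σ ≠ 0) :
    (gaussianNoise d σ).map (fun x => σ⁻¹ • x) = stdGaussian (Vec d) := by
  rw [gaussianNoise, Measure.map_map (by fun_prop) (by fun_prop)]
  simp [Function.comp_def, smul_smul, inv_mul_cancel₀ hσ]

theorem lintegral_add_gaussianNoise {σ : ℝ} (hσ : σ ≠ 0) (a : Vec d) {f : Vec d → ENNReal}
    (hf : Measurable f) :
    ∫⁻ x, f (x + σ • a) ∂(gaussianNoise d σ) =
      ∫⁻ x, ENNReal.ofReal (shiftDensity a (σ⁻¹ • x)) * f x ∂(gaussianNoise d σ) := by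
  have hsm : Measurable fun x : Vec d => σ • x := by fun_prop
  have h1 : Measurable fun x : Vec d => f (x + σ • a) := hf.comp (by fun_prop)
  have h2 : Measurable fun x : Vec d => ENNReal.ofReal (shiftDensity a (σ⁻¹ • x)) * f x :=
    (measurable_shiftDensity measurable_const (by fun_prop)).ennreal_ofReal.mul hf
  rw [gaussianNoise, lintegral_map h1 hsm, lintegral_map h2 hsm]
  simp only [← smul_add, smul_smul, inv_mul_cancel₀ hσ, one_smul]
  exact lintegral_add_stdGaussian a (f := fun x => f (σ • x)) (hf.comp hsm)

/-- Erases the indicator of sample `j` from the coins of a client and adds `σ a` to the noise. -/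
noncomputable def moveClient (σ : ℝ) (j : Fin m) (a : Vec d) (y : ClientCoins m d U) :
    ClientCoins m d U :=
  (Function.update y.1 j false, y.2.1 + σ • a, y.2.2)

theorem measurable_update_bool (j : Fin m) :
    Measurable fun I : Fin m → Bool => Function.update I j false := measurable_of_finite _

theorem measurable_moveClient (σ : ℝ) (j : Fin m) :
    Measurable fun p : Vec d × ClientCoins m d U => moveClient σ j p.1 p.2 := by
  have := measurable_update_bool (m := m) j
  unfold moveClient
  refine Measurable.prodMk (this.comp measurable_snd.fst) (Measurable.prodMk ?_ ?_) <;> fun_prop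

/-- The coins of a client in one round: the indicator of sample `j` is independent of the rest, and
a shift of the noise amounts to a reweighting. -/
theorem lintegral_coinsLaw_moveClient {σ : ℝ} (hσ : σ ≠ 0) (h : b ≤ m) (C : Compressors n d U)
    (i : Fin n) (t : ℕ) (j : Fin m) {g : ClientCoins m d U → Bool → ENNReal}
    (hg : ∀ β, Measurable fun y => g y β) (a : Bool → Vec d) :
    ∫⁻ y, g (moveClient σ j (a (y.1 j)) y) (y.1 j) ∂(coinsLaw h σ C i t) =
      ∑ β, ∫⁻ y, ENNReal.ofReal ((if β then ((samplingRate h : unitInterval) : ℝ)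
        else 1 - samplingRate h) * shiftDensity (a β) (σ⁻¹ • y.2.1)) * g (moveClient σ j 0 y) β
          ∂(coinsLaw h σ C i t) := by
  have := C.isProbabilityMeasure_seedLaw i t
  set q : ℝ := ((samplingRate h : unitInterval) : ℝ) with hq
  have hw : ∀ β : Bool, 0 ≤ (if β then q else 1 - q) := fun β => by
    have h1 := (samplingRate h).2.1
    have h2 := (samplingRate h).2.2
    split_ifs
    · exact h1
    · exact sub_nonneg.2 h2
  have hmv : ∀ a, Measurable (moveClient (U := U) (d := d) σ j a) := fun a =>
    (measurable_moveClient σ j).comp measurable_prodMk_left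
  have hbit : Measurable fun y : ClientCoins m d U => y.1 j :=
    (measurable_pi_apply j).comp measurable_fst
  have hL : Measurable fun y : ClientCoins m d U => g (moveClient σ j (a (y.1 j)) y) (y.1 j) :=
    measurable_of_measurable_section (f := fun y β => g (moveClient σ j (a β) y) β)
      (fun β => (hg β).comp (hmv (a β))) measurable_id hbit
  have hR : ∀ β, Measurable fun y : ClientCoins m d U => ENNReal.ofReal ((if β then q else 1 - q) *
      shiftDensity (a β) (σ⁻¹ • y.2.1)) * g (moveClient σ j 0 y) β := fun β =>
    ((measurable_shiftDensity measurable_const (by fun_prop)).const_mul _).ennreal_ofReal.mul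
      ((hg β).comp (hmv 0))
  -- the average over the noise and the compressor, for a given minibatch
  set K : (Fin m → Bool) → Bool → ENNReal := fun I β =>
    ∫⁻ z, ENNReal.ofReal (shiftDensity (a β) (σ⁻¹ • z.1)) * g (I, z.1, z.2) β
      ∂((gaussianNoise d σ).prod (C.seedLaw i t)) with hK
  have hshift : ∀ I β, ∫⁻ z, g (I, z.1 + σ • a β, z.2) β
      ∂((gaussianNoise d σ).prod (C.seedLaw i t)) = K I β := by
    intro I β
    have m1 : Measurable fun z : Vec d × U => g (I, z.1 + σ • a β, z.2) β :=
      (hg β).comp (by fun_prop)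
    have m2 : Measurable fun z : Vec d × U =>
        ENNReal.ofReal (shiftDensity (a β) (σ⁻¹ • z.1)) * g (I, z.1, z.2) β :=
      (measurable_shiftDensity measurable_const (by fun_prop)).ennreal_ofReal.mul
        ((hg β).comp (by fun_prop))
    rw [hK, lintegral_prod_symm' _ m1]
    simp only
    rw [lintegral_prod_symm' _ m2]
    exact lintegral_congr fun u => lintegral_add_gaussianNoise hσ (a β)
      (f := fun x => g (I, x, u) β) ((hg β).comp (by fun_prop))
  have hKm : Measurable fun I : Fin m → Bool => K (Function.update I j false) (I j) :=
    measurable_of_finite _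
  unfold coinsLaw
  rw [lintegral_prod _ hL.aemeasurable]
  simp only [moveClient, hshift]
  rw [lintegral_pi_update _ j hKm]
  simp only [Function.update_idem, Function.update_self, lintegral_bernoulliMeasure_bool]
  rw [lintegral_finsetSum _ fun β _ => measurable_of_finite _]
  refine Finset.sum_congr rfl fun β _ => ?_
  have hRβ := hR β
  simp only [moveClient] at hRβ
  rw [lintegral_prod _ hRβ.aemeasurable]
  refine lintegral_congr fun I => ?_
  rw [hK, ← lintegral_const_mul' _ _ ENNReal.ofReal_ne_top]
  refine lintegral_congr fun z => ?_
  rw [ENNReal.ofReal_mul (hw β), mul_assoc]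
  simp [hq]

/-- The coins of all clients in one round. -/
noncomputable def roundLaw (h : b ≤ m) (σ : ℝ) (C : Compressors n d U) (t : ℕ) :
    Measure (Fin n → ClientCoins m d U) :=
  Measure.pi fun i => coinsLaw h σ C i t

instance (h : b ≤ m) (σ : ℝ) (C : Compressors n d U) (t : ℕ) :
    IsProbabilityMeasure (roundLaw h σ C t) := by
  unfold roundLaw
  infer_instance

/-- Erases the indicator of sample `j` of client `i` and adds `σ a` to the noise of this client. -/
noncomputable def moveCoins (σ : ℝ) (i : Fin n) (j : Fin m) (a : Vec d)
    (c : Fin n → ClientCoins m d U) : Fin n → ClientCoins m d U :=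
  Function.update c i (moveClient σ j a (c i))

theorem measurable_moveCoins (σ : ℝ) (i : Fin n) (j : Fin m) :
    Measurable fun p : Vec d × (Fin n → ClientCoins m d U) => moveCoins σ i j p.1 p.2 :=
  (measurable_update_prod i).comp (measurable_snd.prodMk ((measurable_moveClient σ j).comp
    (measurable_fst.prodMk ((measurable_pi_apply i).comp measurable_snd))))

/-- The coins of one round in a run without sample `j` of client `i`. -/
noncomputable def erasedLaw (h : b ≤ m) (σ : ℝ) (C : Compressors n d U) (i : Fin n) (j : Fin m)
    (t : ℕ) : Measure (Fin n → ClientCoins m d U) :=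
  (roundLaw h σ C t).map (moveCoins σ i j 0)

theorem measurable_moveCoins_right (σ : ℝ) (i : Fin n) (j : Fin m) (a : Vec d) :
    Measurable (moveCoins (U := U) σ i j a) :=
  (measurable_moveCoins σ i j).comp measurable_prodMk_left

instance (h : b ≤ m) (σ : ℝ) (C : Compressors n d U) (i : Fin n) (j : Fin m) (t : ℕ) :
    IsProbabilityMeasure (erasedLaw h σ C i j t) :=
  Measure.isProbabilityMeasure_map (measurable_moveCoins_right σ i j 0).aemeasurable

theorem lintegral_roundLaw_moveCoins {σ : ℝ} (hσ : σ ≠ 0) (h : b ≤ m) (C : Compressors n d U)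
    (i : Fin n) (j : Fin m) (t : ℕ) (g : (Fin n → ClientCoins m d U) → Bool → ENNReal)
    (hg : ∀ β, Measurable fun c => g c β) (a : Bool → Vec d) :
    ∫⁻ c, g (moveCoins σ i j (a ((c i).1 j)) c) ((c i).1 j) ∂(roundLaw h σ C t) =
      ∑ β, ∫⁻ c, ENNReal.ofReal ((if β then ((samplingRate h : unitInterval) : ℝ)
        else 1 - samplingRate h) * shiftDensity (a β) (σ⁻¹ • (c i).2.1)) * g c β
          ∂(erasedLaw h σ C i j t) := by
  have hci : Measurable fun c : Fin n → ClientCoins m d U => c i := measurable_pi_apply i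
  have hbit : Measurable fun c : Fin n → ClientCoins m d U => (c i).1 j :=
    (measurable_pi_apply j).comp hci.fst
  have hmv := fun a => measurable_moveCoins_right (U := U) (d := d) σ i j a
  have hg' : ∀ β, Measurable fun c => g (moveCoins σ i j (a β) c) β :=
    fun β => (hg β).comp (hmv (a β))
  have hL : Measurable fun c : Fin n → ClientCoins m d U =>
      g (moveCoins σ i j (a ((c i).1 j)) c) ((c i).1 j) :=
    measurable_of_measurable_section (g := fun c => c) hg' measurable_id hbit
  set r : Bool → (Fin n → ClientCoins m d U) → ENNReal := fun β c =>
    ENNReal.ofReal ((if β then ((samplingRate h : unitInterval) : ℝ) else 1 - samplingRate h) *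
      shiftDensity (a β) (σ⁻¹ • (c i).2.1)) * g c β with hr
  have hnoise : Measurable fun c : Fin n → ClientCoins m d U => σ⁻¹ • (c i).2.1 :=
    (measurable_const_smul σ⁻¹).comp hci.snd.fst
  have hR : ∀ β, Measurable (r β) := fun β =>
    ((measurable_shiftDensity measurable_const hnoise).const_mul _).ennreal_ofReal.mul (hg β)
  have hone : ∀ c : Fin n → ClientCoins m d U,
      ∫⁻ y, g (Function.update c i (moveClient σ j (a (y.1 j)) y)) (y.1 j) ∂(coinsLaw h σ C i t) =
        ∑ β, ∫⁻ y, r β (Function.update c i (moveClient σ j 0 y)) ∂(coinsLaw h σ C i t) := by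
    intro c
    rw [lintegral_coinsLaw_moveClient hσ h C i t j
      (g := fun y β => g (Function.update c i y) β)
      (fun β => (hg β).comp (measurable_update c)) a]
    simp only [hr, Function.update_self, moveClient, smul_zero, add_zero]
  have hsec : ∀ β (c : Fin n → ClientCoins m d U),
      ∫⁻ y, r β (moveCoins σ i j 0 (Function.update c i y)) ∂(coinsLaw h σ C i t) =
        ∫⁻ y, r β (Function.update c i (moveClient σ j 0 y)) ∂(coinsLaw h σ C i t) := by
    intro β c
    simp only [moveCoins, Function.update_self, Function.update_idem]
  have hjoint : ∀ β, Measurable fun c : Fin n → ClientCoins m d U =>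
      ∫⁻ y, r β (Function.update c i (moveClient σ j 0 y)) ∂(coinsLaw h σ C i t) := by
    intro β
    have hu : Measurable fun p : (Fin n → ClientCoins m d U) × ClientCoins m d U =>
        r β (Function.update p.1 i (moveClient σ j 0 p.2)) :=
      (hR β).comp ((measurable_update_prod i).comp (measurable_fst.prodMk
        ((measurable_moveClient σ j).comp (measurable_const.prodMk measurable_snd))))
    exact hu.lintegral_prod_right'
  calc _ = ∫⁻ c, ∑ β, ∫⁻ y, r β (Function.update c i (moveClient σ j 0 y)) ∂(coinsLaw h σ C i t)
        ∂(roundLaw h σ C t) := by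
        rw [roundLaw, lintegral_pi_update _ i hL]
        refine lintegral_congr fun c => ?_
        rw [← hone c]
        simp only [moveCoins, Function.update_self, Function.update_idem]
    _ = ∑ β, ∫⁻ c, r β (moveCoins σ i j 0 c) ∂(roundLaw h σ C t) := by
        rw [lintegral_finsetSum _ fun β _ => hjoint β]
        refine Finset.sum_congr rfl fun β _ => ?_
        exact (lintegral_congr fun c => (hsec β c).symm).trans
          (lintegral_pi_update _ i ((hR β).comp (hmv 0))).symm
    _ = _ := by
        refine Finset.sum_congr rfl fun β _ => ?_
        rw [erasedLaw, lintegral_map (hR β) (hmv 0)]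

end SoteriaFL

/-! ### Runs without the differing sample -/

namespace SoteriaFL

variable {n m d b : ℕ} {𝒳 R U : Type*} [MeasurableSpace R] [MeasurableSpace U]

/-- The view of a sample with minibatch indicators `β`, if the messages `v` have been sent. -/
noncomputable def viewOf (x₀ : Vec d) (η γ : ℕ → ℝ) (t : ℕ) (v : Messages n d t) (r : R)
    (β : Fin t → Bool) : View n d R t :=
  (fun s => iterate x₀ η γ s (v.take s (Nat.le_of_lt_succ s.isLt)), v, r, β)

theorem measurable_viewOf (x₀ : Vec d) (η γ : ℕ → ℝ) (t : ℕ) (r : R) (β : Fin t → Bool) :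
    Measurable fun v : Messages n d t => viewOf x₀ η γ t v r β := by
  refine Measurable.prodMk (measurable_pi_lambda _ fun s => (measurable_iterate x₀ η γ s).comp
    (measurable_pi_lambda _ fun k => measurable_pi_apply _)) ?_
  exact measurable_id.prodMk (measurable_const.prodMk measurable_const)

theorem run_succ (x₀ : Vec d) (η γ : ℕ → ℝ) (E : Estimator n m d 𝒳 R) (C : Compressors n d U)
    (D : Fin n → Fin m → 𝒳) (r : R) (t : ℕ) (ω : Fin (t + 1) → Fin n → ClientCoins m d U) :
    run b x₀ η γ E C D r (t + 1) ω =
      Fin.snoc (α := fun _ => Fin n → Vec d) (run b x₀ η γ E C D r t (Fin.init ω)) fun i =>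
        C.apply i t (ω (Fin.last t) i).2.2
          (E.gradient b i t (D i) (fun j => viewOf x₀ η γ t (run b x₀ η γ E C D r t (Fin.init ω)) r
            fun s => (ω s.castSucc i).1 j) (ω (Fin.last t) i).1 + (ω (Fin.last t) i).2.1 -
            clientShift γ i t (run b x₀ η γ E C D r t (Fin.init ω))) :=
  rfl

/-- The data matter only through the terms of the gradient estimator. -/
theorem run_congr_data (x₀ : Vec d) (η γ : ℕ → ℝ) (E : Estimator n m d 𝒳 R) (C : Compressors n d U)
    {D D' : Fin n → Fin m → 𝒳} (hφ : ∀ i t j w, E.φ i t j (D i j) w = E.φ i t j (D' i j) w)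
    (hψ : ∀ i t j w, E.ψ i t j (D i j) w = E.ψ i t j (D' i j) w) (r : R) (t : ℕ)
    (ω : Fin t → Fin n → ClientCoins m d U) :
    run b x₀ η γ E C D r t ω = run b x₀ η γ E C D' r t ω := by
  induction t with
  | zero => rfl
  | succ t ih => simp only [run_succ, ih, Estimator.gradient, hφ, hψ]

/-- The estimator without sample `j` of client `i`. -/
def Estimator.erase (E : Estimator n m d 𝒳 R) (i : Fin n) (j : Fin m) : Estimator n m d 𝒳 R where
  φ k t l z w := if k = i ∧ l = j then 0 else E.φ k t l z w
  ψ k t l z w := if k = i ∧ l = j then 0 else E.ψ k t l z w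
  seedLaw := E.seedLaw
  measurable_φ k t l z := by
    split_ifs
    · exact measurable_const
    · exact E.measurable_φ k t l z
  measurable_ψ k t l z := by
    split_ifs
    · exact measurable_const
    · exact E.measurable_ψ k t l z
  isProbabilityMeasure_seedLaw := E.isProbabilityMeasure_seedLaw

theorem gradient_erase_of_ne (E : Estimator n m d 𝒳 R) {i k : Fin n} (hk : k ≠ i) (j : Fin m)
    (t : ℕ) (Dk : Fin m → 𝒳) (w : Fin m → View n d R t) (I : Fin m → Bool) :
    (E.erase i j).gradient b k t Dk w I = E.gradient b k t Dk w I := by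
  simp [Estimator.gradient, Estimator.erase, hk]

/-- Sample `j` enters the gradient of client `i` by an additive term. Without it, neither its view
nor its minibatch indicator matters. -/
theorem gradient_eq_erase_add (E : Estimator n m d 𝒳 R) (i : Fin n) (j : Fin m)
    (t : ℕ) (Di : Fin m → 𝒳) {w w' : Fin m → View n d R t} {I I' : Fin m → Bool}
    (hw : ∀ l, l ≠ j → w' l = w l) (hI : ∀ l, l ≠ j → I' l = I l) :
    E.gradient b i t Di w I = (E.erase i j).gradient b i t Di w' I' +
      contribution ((1 / (b : ℝ)) • E.φ i t j (Di j) (w j)) ((1 / (m : ℝ)) • E.ψ i t j (Di j) (w j))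
        (I j) := by
  have hφ : ∑ l with I l = true, E.φ i t l (Di l) (w l) =
      ∑ l with I' l = true, (E.erase i j).φ i t l (Di l) (w' l) +
        if I j then E.φ i t j (Di j) (w j) else 0 := by
    rw [Finset.sum_filter, Finset.sum_filter, ← Finset.sum_erase_add _ _ (Finset.mem_univ j),
      ← Finset.sum_erase_add (a := j) Finset.univ (fun l => if I' l = true then _ else 0)
        (Finset.mem_univ j)]
    have : (if I' j = true then (E.erase i j).φ i t j (Di j) (w' j) else 0) = 0 := by
      simp [Estimator.erase]
    rw [this, add_zero]
    congr 1
    refine Finset.sum_congr rfl fun l hl => ?_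
    have hl := Finset.ne_of_mem_erase hl
    simp [Estimator.erase, hl, hw l hl, hI l hl]
  have hψ : ∑ l, E.ψ i t l (Di l) (w l) =
      ∑ l, (E.erase i j).ψ i t l (Di l) (w' l) + E.ψ i t j (Di j) (w j) := by
    rw [← Finset.sum_erase_add _ _ (Finset.mem_univ j),
      ← Finset.sum_erase_add (a := j) Finset.univ (fun l => (E.erase i j).ψ i t l (Di l) (w' l))
        (Finset.mem_univ j)]
    have : (E.erase i j).ψ i t j (Di j) (w' j) = 0 := by simp [Estimator.erase]
    rw [this, add_zero]
    congr 1
    refine Finset.sum_congr rfl fun l hl => ?_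
    have hl := Finset.ne_of_mem_erase hl
    simp [Estimator.erase, hl, hw l hl]
  rw [Estimator.gradient, Estimator.gradient, hφ, hψ, smul_add, smul_add, contribution]
  split_ifs
  · abel
  · simp only [smul_zero]
    abel

section Terms

variable (b) (x₀ : Vec d) (η γ : ℕ → ℝ) (E : Estimator n m d 𝒳 R) (C : Compressors n d U)
  (D : Fin n → Fin m → 𝒳) (r : R) (σ : ℝ) (i : Fin n) (j : Fin m)

/-- The minibatch term of sample `j` of client `i`, in units of the noise level, as a function of
the coins of a run without this sample. -/
noncomputable def minibatchTerm (t : ℕ) (x : Fin t → Fin n → ClientCoins m d U)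
    (β : Fin t → Bool) : Vec d :=
  σ⁻¹ • (1 / (b : ℝ)) • E.φ i t j (D i j)
    (viewOf x₀ η γ t (run b x₀ η γ (E.erase i j) C D r t x) r β)

/-- The full gradient term of sample `j` of client `i`, in units of the noise level. -/
noncomputable def fullTerm (t : ℕ) (x : Fin t → Fin n → ClientCoins m d U)
    (β : Fin t → Bool) : Vec d :=
  σ⁻¹ • (1 / (m : ℝ)) • E.ψ i t j (D i j)
    (viewOf x₀ η γ t (run b x₀ η γ (E.erase i j) C D r t x) r β)

theorem measurable_run_right (t : ℕ) : Measurable (run b x₀ η γ E C D r t) :=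
  (measurable_run x₀ η γ E C D t).comp measurable_prodMk_left

theorem measurable_minibatchTerm (t : ℕ) (β : Fin t → Bool) :
    Measurable fun x => minibatchTerm b x₀ η γ E C D r σ i j t x β :=
  (measurable_const_smul σ⁻¹).comp ((measurable_const_smul (1 / (b : ℝ))).comp
    ((E.measurable_φ i t j (D i j)).comp ((measurable_viewOf x₀ η γ t r β).comp
      (measurable_run_right b x₀ η γ (E.erase i j) C D r t))))

theorem measurable_fullTerm (t : ℕ) (β : Fin t → Bool) :
    Measurable fun x => fullTerm b x₀ η γ E C D r σ i j t x β :=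
  (measurable_const_smul σ⁻¹).comp ((measurable_const_smul (1 / (m : ℝ))).comp
    ((E.measurable_ψ i t j (D i j)).comp ((measurable_viewOf x₀ η γ t r β).comp
      (measurable_run_right b x₀ η γ (E.erase i j) C D r t))))

/-- The coins that `replay` produces: those of a run without sample `j` of client `i` that leads to
the same messages. -/
noncomputable def erasedCoins (t : ℕ) (ω : Fin t → Fin n → ClientCoins m d U) :
    Fin t → Fin n → ClientCoins m d U :=
  replay (moveCoins σ i j) (fun c => (c i).1 j) (minibatchTerm b x₀ η γ E C D r σ i j)
    (fullTerm b x₀ η γ E C D r σ i j) t ω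

theorem erasedCoins_apply_ne (t : ℕ) (ω : Fin t → Fin n → ClientCoins m d U) (s : Fin t)
    {k : Fin n} (hk : k ≠ i) : erasedCoins b x₀ η γ E C D r σ i j t ω s k = ω s k := by
  induction t with
  | zero => exact s.elim0
  | succ t ih =>
    unfold erasedCoins at ih ⊢
    rw [replay]
    induction s using Fin.lastCases with
    | last => simp [moveCoins, hk]
    | cast s =>
      rw [Fin.snoc_castSucc]
      exact ih (Fin.init ω) s

theorem erasedCoins_apply_minibatch (t : ℕ) (ω : Fin t → Fin n → ClientCoins m d U) (s : Fin t)
    {l : Fin m} (hl : l ≠ j) :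
    (erasedCoins b x₀ η γ E C D r σ i j t ω s i).1 l = (ω s i).1 l := by
  induction t with
  | zero => exact s.elim0
  | succ t ih =>
    unfold erasedCoins at ih ⊢
    rw [replay]
    induction s using Fin.lastCases with
    | last => simp [moveCoins, moveClient, hl]
    | cast s =>
      rw [Fin.snoc_castSucc]
      exact ih (Fin.init ω) s

theorem contribution_smul (c : ℝ) (x y : Vec d) (β : Bool) :
    contribution (c • x) (c • y) β = c • contribution x y β := by
  cases β <;> simp [contribution]

/-- The messages of a run are those of a run without sample `j` of client `i`, in which the
contribution of the sample has been moved to the noise. -/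
theorem run_eq_run_erasedCoins (hσ : σ ≠ 0) (t : ℕ) (ω : Fin t → Fin n → ClientCoins m d U) :
    run b x₀ η γ E C D r t ω =
      run b x₀ η γ (E.erase i j) C D r t (erasedCoins b x₀ η γ E C D r σ i j t ω) := by
  induction t with
  | zero => rfl
  | succ t ih =>
    have hinit : (Fin.init (erasedCoins b x₀ η γ E C D r σ i j (t + 1) ω) :
        Fin t → Fin n → ClientCoins m d U) =
        erasedCoins b x₀ η γ E C D r σ i j t (Fin.init ω) := replay_succ_init t ω
    have hne : ∀ s k, k ≠ i → erasedCoins b x₀ η γ E C D r σ i j (t + 1) ω s k = ω s k :=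
      fun s k hk => erasedCoins_apply_ne b x₀ η γ E C D r σ i j (t + 1) ω s hk
    have hmb : ∀ s l, l ≠ j →
        (erasedCoins b x₀ η γ E C D r σ i j (t + 1) ω s i).1 l = (ω s i).1 l :=
      fun s l hl => erasedCoins_apply_minibatch b x₀ η γ E C D r σ i j (t + 1) ω s hl
    rw [run_succ, run_succ, hinit, ← ih]
    set v := run b x₀ η γ E C D r t (Fin.init ω) with hv
    congr 1
    funext k
    by_cases hk : k = i
    · subst hk
      have hlast : (erasedCoins b x₀ η γ E C D r σ k j (t + 1) ω (Fin.last t) k).2 =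
          ((ω (Fin.last t) k).2.1 + contribution
            ((1 / (b : ℝ)) • E.φ k t j (D k j) (viewOf x₀ η γ t v r fun s => (ω s.castSucc k).1 j))
            ((1 / (m : ℝ)) • E.ψ k t j (D k j) (viewOf x₀ η γ t v r fun s => (ω s.castSucc k).1 j))
            ((ω (Fin.last t) k).1 j), (ω (Fin.last t) k).2.2) := by
        rw [hv, ih]
        unfold erasedCoins
        rw [replay]
        simp only [Fin.snoc_last, moveCoins, Function.update_self, moveClient, minibatchTerm,
          fullTerm, ← contribution_smul σ, smul_inv_smul₀ hσ]
        rfl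
      rw [hlast, gradient_eq_erase_add E k j t (D k)
        (w' := fun l => viewOf x₀ η γ t v r fun s =>
          (erasedCoins b x₀ η γ E C D r σ k j (t + 1) ω s.castSucc k).1 l)
        (I' := (erasedCoins b x₀ η γ E C D r σ k j (t + 1) ω (Fin.last t) k).1)
        (fun l hl => by simp only [hmb _ l hl]) (fun l hl => hmb _ l hl)]
      congr 2
      exact (add_assoc _ _ _).trans (congrArg _ (add_comm _ _))
    · simp only [hne _ k hk]
      rw [gradient_erase_of_ne E hk]

end Terms

end SoteriaFL

/-! ### Privacy of the mechanism -/

namespace SoteriaFL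

variable {n m d b : ℕ} {𝒳 R U : Type*} [MeasurableSpace R] [MeasurableSpace U]

/-- The messages for a fixed seed of the estimator, compared for two neighboring datasets. -/
theorem lintegral_run_le_exp_mul_add (hbm : b ≤ m) (T : ℕ) {σ : ℝ} (hσ : 0 < σ) (x₀ : Vec d)
    (η γ : ℕ → ℝ) (E : Estimator n m d 𝒳 R) (C : Compressors n d U) {GA GB : ℝ}
    (hφ : ∀ i t j z w, ‖E.φ i t j z w‖ ≤ GA) (hψ : ∀ i t j z w, ‖E.ψ i t j z w‖ ≤ GB)
    {D D' : Fin n → Fin m → 𝒳} {i : Fin n} {j : Fin m} (hj : ∀ l, l ≠ j → D i l = D' i l)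
    (hi : ∀ k, k ≠ i → D k = D' k) (r : R) {k : ℕ} (hk : 1 ≤ k)
    (hA : 18 * ((k : ℝ) + 1) * (GA / (b * σ)) ^ 2 ≤ 1) (ε : ℝ)
    {f : Messages n d T → ENNReal} (hf : Measurable f) (hf1 : ∀ v, f v ≤ 1) :
    ∫⁻ ω, f (run b x₀ η γ E C D r T ω) ∂(Measure.pi fun t : Fin T => roundLaw hbm σ C t) ≤
      ENNReal.ofReal (Real.exp ε) *
        ∫⁻ ω, f (run b x₀ η γ E C D' r T ω) ∂(Measure.pi fun t : Fin T => roundLaw hbm σ C t) +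
      ENNReal.ofReal (Real.exp (-(k * ε) +
        T * roundCost ((b : ℝ) / m) (GA / (b * σ)) (GB / (m * σ)) k)) := by
  have hq := (samplingRate hbm).2
  have hci : Measurable fun c : Fin n → ClientCoins m d U => c i := measurable_pi_apply i
  have hbit : Measurable fun c : Fin n → ClientCoins m d U => (c i).1 j :=
    (measurable_pi_apply j).comp hci.fst
  have hN : Measurable fun c : Fin n → ClientCoins m d U => σ⁻¹ • (c i).2.1 :=
    (measurable_const_smul σ⁻¹).comp hci.snd.fst
  have hlaw : ∀ D₀ : Fin n → Fin m → 𝒳,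
      ∫⁻ ω, f (run b x₀ η γ E C D₀ r T ω) ∂(Measure.pi fun t : Fin T => roundLaw hbm σ C t) =
        ∫⁻ x, ENNReal.ofReal (transcriptDensity (samplingRate hbm : unitInterval)
          (fun c => σ⁻¹ • (c i).2.1) (minibatchTerm b x₀ η γ E C D₀ r σ i j)
          (fullTerm b x₀ η γ E C D₀ r σ i j) T x) * f (run b x₀ η γ (E.erase i j) C D₀ r T x)
          ∂(Measure.pi fun t : Fin T => erasedLaw hbm σ C i j t) := by
    intro D₀
    simp only [run_eq_run_erasedCoins b x₀ η γ E C D₀ r σ i j hσ.ne']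
    exact lintegral_replay_eq_transcriptDensity hq.1 hq.2 hN (measurable_moveCoins σ i j) hbit
      (fun t β => measurable_minibatchTerm b x₀ η γ E C D₀ r σ i j t β)
      (fun t β => measurable_fullTerm b x₀ η γ E C D₀ r σ i j t β)
      (fun t g hg a => lintegral_roundLaw_moveCoins hσ.ne' hbm C i j t g hg a) T
      (f := fun x => f (run b x₀ η γ (E.erase i j) C D₀ r T x))
      (hf.comp (measurable_run_right b x₀ η γ (E.erase i j) C D₀ r T))
  have hν : ∀ t, (erasedLaw hbm σ C i j t).map (fun c => σ⁻¹ • (c i).2.1) =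
      stdGaussian (Vec d) := by
    intro t
    have := C.isProbabilityMeasure_seedLaw i t
    rw [erasedLaw, Measure.map_map hN (measurable_moveCoins_right σ i j 0)]
    have e : (fun c : Fin n → ClientCoins m d U => σ⁻¹ • (c i).2.1) ∘ moveCoins σ i j 0 =
        (fun z : Vec d => σ⁻¹ • z) ∘ (Prod.fst ∘ Prod.snd) ∘ Function.eval i := by
      funext c
      simp [moveCoins, moveClient]
    rw [e, ← Measure.map_map (by fun_prop) (by fun_prop),
      ← Measure.map_map (by fun_prop) (by fun_prop), roundLaw,
      (measurePreserving_eval _ i).map_eq, coinsLaw, ← Measure.map_map (by fun_prop) (by fun_prop),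
      Measure.map_snd_prod, Measure.map_smul, Measure.map_fst_prod, Measure.map_smul]
    simp [map_smul_gaussianNoise hσ.ne']
  have hrun : ∀ x, run b x₀ η γ (E.erase i j) C D r T x =
      run b x₀ η γ (E.erase i j) C D' r T x := by
    intro x
    refine run_congr_data x₀ η γ _ C (fun k t l w => ?_) (fun k t l w => ?_) r T x <;>
    · simp only [Estimator.erase]
      split_ifs with hkl
      · rfl
      · by_cases hki : k = i
        · subst hki
          rw [hj l fun hl => hkl ⟨rfl, hl⟩]
        · rw [hi k hki]
  have hbound : ∀ (x : Vec d) (G : ℝ) (N : ℕ), ‖x‖ ≤ G →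
      ‖σ⁻¹ • (1 / (N : ℝ)) • x‖ ≤ G / (N * σ) := by
    intro x G N hx
    rw [norm_smul, norm_smul, Real.norm_of_nonneg (by positivity),
      Real.norm_of_nonneg (by positivity)]
    calc _ ≤ σ⁻¹ * (1 / (N : ℝ) * G) := by gcongr
      _ = _ := by rw [one_div, div_eq_mul_inv, mul_inv]; ring
  rw [hlaw D, hlaw D']
  simp only [hrun]
  exact lintegral_transcriptDensity_le_exp_mul_add hq.1 hq.2 hk hA hN hν
    (fun t β => measurable_minibatchTerm b x₀ η γ E C D r σ i j t β)
    (fun t β => measurable_fullTerm b x₀ η γ E C D r σ i j t β)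
    (fun t β => measurable_minibatchTerm b x₀ η γ E C D' r σ i j t β)
    (fun t β => measurable_fullTerm b x₀ η γ E C D' r σ i j t β)
    (fun t x β => hbound _ _ _ (hφ _ _ _ _ _)) (fun t x β => hbound _ _ _ (hψ _ _ _ _ _))
    (fun t x β => hbound _ _ _ (hφ _ _ _ _ _)) (fun t x β => hbound _ _ _ (hψ _ _ _ _ _))
    T ε (hf.comp (measurable_run_right b x₀ η γ (E.erase i j) C D' r T)) (fun x => hf1 _)

theorem mechanism_apply (h : b ≤ m) (T : ℕ) (σ : ℝ) (x₀ : Vec d) (η γ : ℕ → ℝ)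
    (E : Estimator n m d 𝒳 R) (C : Compressors n d U) (D : Fin n → Fin m → 𝒳)
    {S : Set (Messages n d (T + 1))} (hS : MeasurableSet S) :
    mechanism h T σ x₀ η γ E C D S =
      ∫⁻ r, ∫⁻ ω, S.indicator 1 (run b x₀ η γ E C D r (T + 1) ω)
        ∂(Measure.pi fun t : Fin (T + 1) => roundLaw h σ C t) ∂E.seedLaw := by
  have := E.isProbabilityMeasure_seedLaw
  have hf : Measurable (S.indicator (1 : Messages n d (T + 1) → ENNReal)) :=
    measurable_one.indicator hS
  have hr := measurable_run (b := b) x₀ η γ E C D (T + 1)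
  rw [← lintegral_indicator_one hS, mechanism, lintegral_map hf hr, randomnessLaw]
  exact lintegral_prod _ (hf.comp hr).aemeasurable

/-- As the law of the seed does not depend on the data, privacy may be shown for each seed. -/
theorem isLDP_of_forall_seed (h : b ≤ m) {T : ℕ} {σ : ℝ} {x₀ : Vec d} {η γ : ℕ → ℝ}
    {E : Estimator n m d 𝒳 R} {C : Compressors n d U} {ε δ : ℝ}
    (H : ∀ (i : Fin n) (j : Fin m) (D D' : Fin n → Fin m → 𝒳), (∀ l, l ≠ j → D i l = D' i l) →
      (∀ k, k ≠ i → D k = D' k) → ∀ (r : R) (f : Messages n d (T + 1) → ENNReal), Measurable f →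
        (∀ v, f v ≤ 1) →
        ∫⁻ ω, f (run b x₀ η γ E C D r (T + 1) ω)
          ∂(Measure.pi fun t : Fin (T + 1) => roundLaw h σ C t) ≤
        ENNReal.ofReal (Real.exp ε) * ∫⁻ ω, f (run b x₀ η γ E C D' r (T + 1) ω)
          ∂(Measure.pi fun t : Fin (T + 1) => roundLaw h σ C t) + ENNReal.ofReal δ) :
    IsLDP (mechanism h T σ x₀ η γ E C) ε δ := by
  have := E.isProbabilityMeasure_seedLaw
  rintro i D D' ⟨j, hj⟩ hi S hS
  have hf : Measurable (S.indicator (1 : Messages n d (T + 1) → ENNReal)) :=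
    measurable_one.indicator hS
  rw [mechanism_apply h T σ x₀ η γ E C D hS, mechanism_apply h T σ x₀ η γ E C D' hS]
  calc _ ≤ _ := lintegral_mono fun r => H i j D D' hj hi r _ hf fun v =>
        Set.indicator_le_self' (fun _ _ => zero_le) v
    _ = _ := by
        rw [lintegral_add_right _ measurable_const, lintegral_const_mul' _ _ ENNReal.ofReal_ne_top,
          lintegral_const, measure_univ, mul_one]

/-- The numerical constraints of the privacy analysis, for the order `k + 1` of the Rényi powers
with `k = ⌈2 log(1/δ) / ε⌉`. -/
theorem exists_order {K : ℝ} (hK : 0 < K) {m b T : ℕ} (hb : 1 ≤ b) (hbm : b ≤ m)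
    {GA GB ε L σ : ℝ} (hε : 0 < ε) (hεT : ε < (b : ℝ) ^ 2 * T / (m : ℝ) ^ 2) (hL : 0 < L)
    (hεL : ε ≤ K * L) (hσ : 0 < σ)
    (hσ2 : σ ^ 2 = 8640 * (1 + K) ^ 2 * ((GA ^ 2 / 4 + GB ^ 2) * T * L) / ((m : ℝ) ^ 2 * ε ^ 2)) :
    ∃ k : ℕ, 1 ≤ k ∧ 18 * ((k : ℝ) + 1) * (GA / (b * σ)) ^ 2 ≤ 1 ∧
      -(k * ε) + ((T + 1 : ℕ) : ℝ) * roundCost ((b : ℝ) / m) (GA / (b * σ)) (GB / (m * σ)) k ≤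
        -L := by
  have hb' : (0 : ℝ) < b := by exact_mod_cast hb
  have hm' : (0 : ℝ) < m := by exact_mod_cast hb.trans hbm
  have hT0 : T ≠ 0 := by
    rintro rfl
    norm_num at hεT
    linarith
  have hT1 : (1 : ℝ) ≤ T := by exact_mod_cast Nat.one_le_iff_ne_zero.2 hT0
  set G := GA ^ 2 / 4 + GB ^ 2 with hG
  have hG0 : 0 ≤ G := by positivity
  have hGA : GA ^ 2 ≤ 4 * G := by rw [hG]; nlinarith [sq_nonneg GB]
  have hGB : GA ^ 2 + GB ^ 2 ≤ 4 * G := by rw [hG]; nlinarith [sq_nonneg GB]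
  set c := 8640 * (1 + K) ^ 2 with hc
  have hc0 : 0 < c := by positivity
  -- the noise level solved for the ratio of sensitivity and noise
  have hratio : G * (c * T * L) = σ ^ 2 * m ^ 2 * ε ^ 2 := by
    rw [hσ2]
    field_simp
  set k := ⌈2 * L / ε⌉₊ with hk
  have hk1 : 1 ≤ k := Nat.one_le_ceil_iff.2 (by positivity)
  have hkl : 2 * L ≤ k * ε := by
    rw [← div_le_iff₀ hε]
    exact Nat.le_ceil _
  have hku : ((k : ℝ) + 1) * ε ≤ 2 * (1 + K) * L := by
    have h1 : (k : ℝ) < 2 * L / ε + 1 := Nat.ceil_lt_add_one (by positivity)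
    have h2 : (k : ℝ) * ε ≤ 2 * L + ε := by
      calc _ ≤ (2 * L / ε + 1) * ε := by gcongr
        _ = _ := by field_simp
    nlinarith
  refine ⟨k, hk1, ?_, ?_⟩
  · -- the bound on `ε` turns the noise level into a bound on the minibatch term of one round
    have h1 : ε * m ^ 2 ≤ b ^ 2 * T := by
      rw [lt_div_iff₀ (by positivity)] at hεT
      exact hεT.le
    have h2 : (GA / (b * σ)) ^ 2 * (c * L) ≤ 4 * ε := by
      rw [div_pow, mul_pow, div_mul_eq_mul_div, div_le_iff₀ (by positivity)]
      have h3 : G * (c * L) * b ^ 2 * T = σ ^ 2 * ε ^ 2 * m ^ 2 * b ^ 2 := by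
        linear_combination b ^ 2 * hratio
      have h4 : G * (c * L) * (ε * m ^ 2) ≤ ε * (ε * m ^ 2) * (b ^ 2 * σ ^ 2) := by
        calc _ ≤ G * (c * L) * (b ^ 2 * T) := by gcongr
          _ = _ := by linear_combination h3
      have h5 : G * (c * L) ≤ ε * (b ^ 2 * σ ^ 2) := by
        refine le_of_mul_le_mul_right ?_ (show 0 < ε * (m : ℝ) ^ 2 by positivity)
        linarith
      have h6 : GA ^ 2 * (c * L) ≤ 4 * G * (c * L) := by gcongr
      linarith
    refine le_of_mul_le_mul_right ?_ (show 0 < c * L by positivity)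
    calc _ = 18 * ((k : ℝ) + 1) * ((GA / (b * σ)) ^ 2 * (c * L)) := by ring
      _ ≤ 18 * ((k : ℝ) + 1) * (4 * ε) := by gcongr
      _ = 72 * (((k : ℝ) + 1) * ε) := by ring
      _ ≤ 72 * (2 * (1 + K) * L) := by gcongr
      _ ≤ 1 * (c * L) := by
        rw [hc]
        have : 1 + K ≤ (1 + K) ^ 2 := by nlinarith
        nlinarith [mul_le_mul_of_nonneg_right this hL.le]
  · have hcost : roundCost ((b : ℝ) / m) (GA / (b * σ)) (GB / (m * σ)) k * (c * T * L) ≤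
        1080 * (((k : ℝ) + 1) * ε) ^ 2 := by
      have h1 : ((b : ℝ) / m) ^ 2 * (GA / (b * σ)) ^ 2 + (GB / (m * σ)) ^ 2 =
          (GA ^ 2 + GB ^ 2) / (m ^ 2 * σ ^ 2) := by
        field_simp
      rw [roundCost, h1]
      have h2 : (GA ^ 2 + GB ^ 2) / (m ^ 2 * σ ^ 2) * (c * T * L) ≤ 4 * ε ^ 2 := by
        rw [div_mul_eq_mul_div, div_le_iff₀ (by positivity)]
        calc _ ≤ 4 * G * (c * T * L) := by gcongr
          _ = _ := by linear_combination 4 * hratio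
      calc _ = 270 * ((k : ℝ) + 1) ^ 2 * ((GA ^ 2 + GB ^ 2) / (m ^ 2 * σ ^ 2) * (c * T * L)) := by
            ring
        _ ≤ 270 * ((k : ℝ) + 1) ^ 2 * (4 * ε ^ 2) := by gcongr
        _ = _ := by ring
    have hsq : (((k : ℝ) + 1) * ε) ^ 2 ≤ (2 * (1 + K) * L) ^ 2 := by gcongr
    have htot : ((T + 1 : ℕ) : ℝ) * roundCost ((b : ℝ) / m) (GA / (b * σ)) (GB / (m * σ)) k ≤
        L := by
      have hr0 : 0 ≤ roundCost ((b : ℝ) / m) (GA / (b * σ)) (GB / (m * σ)) k := by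
        unfold roundCost
        positivity
      -- there are `T + 1` rounds, while the noise level is calibrated with `T`
      have h2T : (T : ℝ) + 1 ≤ 2 * T := by linarith
      refine le_of_mul_le_mul_right ?_ (show 0 < c * T * L by positivity)
      push_cast
      calc _ ≤ (2 * T : ℝ) * (roundCost ((b : ℝ) / m) (GA / (b * σ)) (GB / (m * σ)) k *
            (c * T * L)) := by
            rw [mul_assoc]
            exact mul_le_mul_of_nonneg_right h2T (mul_nonneg hr0 (by positivity))
        _ ≤ (2 * T : ℝ) * (1080 * (2 * (1 + K) * L) ^ 2) := by
            exact mul_le_mul_of_nonneg_left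
              (hcost.trans (mul_le_mul_of_nonneg_left hsq (by norm_num))) (by positivity)
        _ = L * (c * T * L) := by
            rw [hc]
            ring
    linarith

end SoteriaFL

theorem theorem1 :
    ∃ c' : ℝ, 0 < c' ∧ ∀ K : ℝ, 0 < K → ∃ c : ℝ, 0 < c ∧
      ∀ (n m d b T : ℕ) (_ : 1 ≤ b) (hbm : b ≤ m)
        (𝒳 R U : Type*) [MeasurableSpace R] [MeasurableSpace U]
        (E : SoteriaFL.Estimator n m d 𝒳 R) (C : SoteriaFL.Compressors n d U)
        (x₀ : SoteriaFL.Vec d) (η γ : ℕ → ℝ) (GA GB : ℝ),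
        (∀ i t j z w, ‖E.φ i t j z w‖ ≤ GA) →
        (∀ i t j z w, ‖E.ψ i t j z w‖ ≤ GB) →
        ∀ ε δ σ : ℝ, 0 < ε → ε < c' * (b : ℝ) ^ 2 * T / (m : ℝ) ^ 2 →
          0 < δ → δ < 1 → ε ≤ K * Real.log (1 / δ) → 0 ≤ σ →
          σ ^ 2 = c * ((GA ^ 2 / 4 + GB ^ 2) * T * Real.log (1 / δ)) / ((m : ℝ) ^ 2 * ε ^ 2) →
          SoteriaFL.IsLDP (SoteriaFL.mechanism hbm T σ x₀ η γ E C) ε δ := by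
  -- `1080 * 4 * 2`: see the cost of a round, `k + 1 ≤ 2 (1 + K) log (1 / δ) / ε` and `T + 1 ≤ 2 T`
  refine ⟨1, one_pos, fun K hK => ⟨8640 * (1 + K) ^ 2, by positivity, ?_⟩⟩
  intro n m d b T hb hbm 𝒳 R U _ _ E C x₀ η γ GA GB hφ hψ ε δ σ hε hεT hδ0 hδ1 hεK hσ0 hσ2
  rw [one_mul] at hεT
  have hL : 0 < Real.log (1 / δ) := Real.log_pos (by rw [lt_div_iff₀ hδ0]; linarith)
  refine SoteriaFL.isLDP_of_forall_seed hbm fun i j D D' hj hi r f hf hf1 => ?_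
  rcases hσ0.eq_or_lt with rfl | hσ
  · -- without noise, the formula for `σ` forces all terms of the estimator to vanish
    have hm : (0 : ℝ) < m := by exact_mod_cast hb.trans hbm
    have hT : (0 : ℝ) < T := by
      refine (Nat.cast_nonneg T).lt_of_ne fun h0 => ?_
      rw [← h0] at hεT
      simp only [mul_zero, zero_div] at hεT
      linarith
    have hG : GA ^ 2 / 4 + GB ^ 2 = 0 := by
      by_contra hne
      have : 0 < GA ^ 2 / 4 + GB ^ 2 := lt_of_le_of_ne (by positivity) (Ne.symm hne)
      have : 0 < 8640 * (1 + K) ^ 2 * ((GA ^ 2 / 4 + GB ^ 2) * T * Real.log (1 / δ)) /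
          ((m : ℝ) ^ 2 * ε ^ 2) := by positivity
      rw [← hσ2] at this
      norm_num at this
    have hGA : GA = 0 := by nlinarith [sq_nonneg GA, sq_nonneg GB]
    have hGB : GB = 0 := by nlinarith [sq_nonneg GA, sq_nonneg GB]
    have hφ0 : ∀ i t j z w, E.φ i t j z w = 0 := fun i t j z w =>
      norm_le_zero_iff.1 (hGA ▸ hφ i t j z w)
    have hψ0 : ∀ i t j z w, E.ψ i t j z w = 0 := fun i t j z w =>
      norm_le_zero_iff.1 (hGB ▸ hψ i t j z w)
    simp only [SoteriaFL.run_congr_data x₀ η γ E C (D := D) (D' := D')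
      (fun i t j w => by rw [hφ0, hφ0]) (fun i t j w => by rw [hψ0, hψ0])]
    refine le_add_right (le_mul_of_one_le_left' ?_)
    exact ENNReal.one_le_ofReal.2 (Real.one_le_exp hε.le)
  obtain ⟨k, hk, hA, hcost⟩ := SoteriaFL.exists_order hK hb hbm hε hεT hL hεK hσ hσ2
  refine (SoteriaFL.lintegral_run_le_exp_mul_add hbm (T + 1) hσ x₀ η γ E C hφ hψ hj hi r hk hA ε
    hf hf1).trans (add_le_add le_rfl (ENNReal.ofReal_le_ofReal ?_))
  calc _ ≤ Real.exp (-Real.log (1 / δ)) := Real.exp_le_exp.2 hcost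
    _ = δ := by rw [one_div, Real.log_inv, neg_neg, Real.exp_log hδ0]
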